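/- **Theorem.** A *graph* in a complex Banach space $X$ is a linear subspace $A\subseteq X\times X$; put $\lambda I+A=\{(u,\lambda u+f):(u,f)\in A\}$ and call a graph *boundedly invertible* if its inverse $\{(f,u):(u,f)\in B\}$ is the graph of an everywhere defined bounded operator $B^{-1}$. A *degenerate semigroup* is a family $S=(S_t)_{t\in(0,\infty)}$ in $\mathcal L(X)$ that is strongly continuous on $(0,\infty)$ and satisfies $S_{t+s}=S_tS_s$ for all $t,s>0$ and $\sup_{0<t<1}\|S_t\|<\infty$. One says that $-A$ *generates* $S$ if there is an $\omega\in\mathbb R$ such that, for all real $\lambda>\omega$, $\lambda I+A$ is boundedly invertible and $(\lambda I+A)^{-1}x=\int_0^\infty e^{-\lambda t}S_tx\,dt$ (a convergent Bochner integral) for all $x\in X$. Let $H$ be a complex Hilbert space, with inner product $(\cdot,\cdot)_H$ linear in the first variable. Let $A_n$ ($n\in\mathbb N$) and $A$ be positive self-adjoint graphs in $H$; that is, each of these graphs $B$ equals its adjoint $\{(v,g):(f,v)_H=(u,g)_H\text{ for all }(u,f)\in B\}$, and $(f,u)_H\ge 0$ for all $(u,f)\in B$. Let $S^{(n)}$ and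 $S$ be the degenerate semigroups generated by $-A_n$ and $-A$. Then the following are equivalent. (A statement that resolvents converge includes that the inverses involved exist as bounded operators; WOT and SOT are the weak and strong operator topologies.) 1. $\lim_{n\to\infty}S^{(n)}_t=S_t$ in $(\mathcal L(H),\mathrm{WOT})$ for all $t\in(0,\infty)$. 2. $\lim_{n\to\infty}\int_0^T(S^{(n)}_tf,g)_H\,dt=\int_0^T(S_tf,g)_H\,dt$ for all $T>0$ and $f,g\in H$. 3. $\lim_{n\to\infty}\int_0^T(S^{(n)}_tf,g(t))_H\,dt=\int_0^T(S_tf,g(t))_H\,dt$ for all $T>0$, $f\in H$ and $g\in L_1([0,T],H)$. 4. $\lim_{n\to\infty}\int_0^T\|(S^{(n)}_t-S_t)f\|_H\,dt=0$ for all $T>0$ and $f\in H$. 5. $\lim_{n\to\infty}(\lambda I+A_n)^{-1}=(\lambda I+A)^{-1}$ in $(\mathcal L(H),\mathrm{SOT})$ for all $\lambda\in\mathbb C$ with $\operatorname{Re}\lambda>0$. 6. There exists a $\lambda\in\mathbb C$ with $\operatorname{Re}\lambda>0$ such that $\lim_{n\to\infty}(\lambda I+A_n)^{-1}=(\lambda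 I+A)^{-1}$ in $(\mathcal L(H),\mathrm{SOT})$. 7. $\lim_{n\to\infty}(\lambda I+A_n)^{-1}=(\lambda I+A)^{-1}$ in $(\mathcal L(H),\mathrm{WOT})$ for all $\lambda\in\mathbb C$ with $\operatorname{Re}\lambda>0$. 8. There exists a set $D\subseteq\mathbb C$ with an accumulation point in the open right half-plane $\{\mu\in\mathbb C:\operatorname{Re}\mu>0\}$ such that $\lim_{n\to\infty}(\lambda I+A_n)^{-1}=(\lambda I+A)^{-1}$ in $(\mathcal L(H),\mathrm{WOT})$ for all $\lambda\in D$. 9. There exists a $\lambda\in\mathbb C\setminus\mathbb R$ with $\operatorname{Re}\lambda>0$ such that $\lim_{n\to\infty}(\lambda I+A_n)^{-1}=(\lambda I+A)^{-1}$ in $(\mathcal L(H),\mathrm{WOT})$. 10. $\lim_{n\to\infty}\sup_{t\in[\delta,T]}\|(S^{(n)}_t-S_t)f\|_H=0$ for all $f\in H$ and $\delta,T>0$ with $\delta<T$. -/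

import Mathlib

open Filter Topology MeasureTheory Set

noncomputable section

/-- A graph in `X` (a linear relation, or multivalued linear operator): a linear subspace of
`X × X`. A pair `(u, f)` in the graph is read as `f ∈ A u`. -/
abbrev OpGraph (X : Type*) [NormedAddCommGroup X] [NormedSpace ℂ X] := Submodule ℂ (X × X)

namespace OpGraph

section Banach

variable {X : Type*} [NormedAddCommGroup X] [NormedSpace ℂ X]

/-- The graph `l I + A = {(u, l u + f) : (u, f) ∈ A}`. -/
def scalarAdd (l : ℂ) (A : OpGraph X) : OpGraph X :=
  A.map ((LinearMap.fst ℂ X X).prod (l • LinearMap.fst ℂ X X + LinearMap.snd ℂ X X))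

lemma mem_scalarAdd {l : ℂ} {A : OpGraph X} {u f : X} :
    (u, f) ∈ scalarAdd l A ↔ (u, f - l • u) ∈ A := by
  rw [scalarAdd, Submodule.mem_map]
  constructor
  · rintro ⟨⟨a, b⟩, h, hab⟩
    obtain ⟨rfl, rfl⟩ := Prod.mk.inj hab
    simpa using h
  · intro h
    exact ⟨(u, f - l • u), h, Prod.ext rfl (by simp)⟩

/-- The inverse graph `{(f, u) : (u, f) ∈ B}`. -/
def inverse (B : OpGraph X) : OpGraph X :=
  B.map (LinearEquiv.prodComm ℂ X X).toLinearMap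

lemma mem_inverse {B : OpGraph X} {u f : X} : (f, u) ∈ inverse B ↔ (u, f) ∈ B := by
  simp [inverse]

/-- A graph is boundedly invertible if its inverse graph is the graph of an everywhere defined
bounded linear operator. -/
def BoundedlyInvertible (B : OpGraph X) : Prop :=
  ∃ R : X →L[ℂ] X, inverse B = (R : X →ₗ[ℂ] X).graph

open Classical in
/-- The bounded operator `B⁻¹` of a boundedly invertible graph `B` (and `0` if `B` is not
boundedly invertible). -/
def boundedInverse (B : OpGraph X) : X →L[ℂ] X :=
  if h : BoundedlyInvertible B then h.choose else 0

lemma inverse_eq_graph {B : OpGraph X} (h : BoundedlyInvertible B) :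
    inverse B = (boundedInverse B : X →ₗ[ℂ] X).graph := by
  rw [boundedInverse, dif_pos h]
  exact h.choose_spec

lemma mem_iff_boundedInverse {B : OpGraph X} (h : BoundedlyInvertible B) {u f : X} :
    (u, f) ∈ B ↔ u = boundedInverse B f := by
  rw [← mem_inverse, inverse_eq_graph h, LinearMap.mem_graph_iff]
  rfl

/-- `(l I + A)⁻¹`, meaningful when `l I + A` is boundedly invertible. -/
def resolvent (A : OpGraph X) (l : ℂ) : X →L[ℂ] X := boundedInverse (scalarAdd l A)

end Banach

section Hilbert

variable {H : Type*} [NormedAddCommGroup H] [InnerProductSpace ℂ H]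

/-- A graph is self-adjoint if it equals its adjoint graph
`{(v, g) : ⟪f, v⟫ = ⟪u, g⟫ for all (u, f) ∈ A}`. -/
def SelfAdjoint (A : OpGraph H) : Prop := Submodule.adjoint A = A

/-- A graph is positive if the inner product of `f` and `u` is real and nonnegative for all
`(u, f) ∈ A`. -/
def Positive (A : OpGraph H) : Prop :=
  ∀ u f : H, (u, f) ∈ A → 0 ≤ (inner ℂ u f).re ∧ (inner ℂ u f).im = 0

end Hilbert

end OpGraph

section Semigroup

variable {X : Type*} [NormedAddCommGroup X] [NormedSpace ℂ X]

/-- A degenerate semigroup: a family `S t`, `t ∈ (0,∞)`, of bounded operators that is strongly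
continuous on `(0,∞)`, satisfies the semigroup law, and is bounded on `(0,1)`. The values `S t` for
`t ≤ 0` are irrelevant. -/
structure IsDegenerateSemigroup (S : ℝ → X →L[ℂ] X) : Prop where
  continuousOn : ∀ x : X, ContinuousOn (fun t => S t x) (Ioi 0)
  add : ∀ t s : ℝ, 0 < t → 0 < s → S (t + s) = S t ∘L S s
  bddAbove : BddAbove ((fun t => ‖S t‖) '' Ioo 0 1)

/-- `-A` is the generator of the degenerate semigroup `S`: for all sufficiently large real `l`, the
graph `l I + A` is boundedly invertible and its inverse is the (convergent) Laplace transform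
of `S` at `l`. -/
def NegGenerates (A : OpGraph X) (S : ℝ → X →L[ℂ] X) : Prop :=
  IsDegenerateSemigroup S ∧
  ∃ ω : ℝ, ∀ l : ℝ, ω < l →
    OpGraph.BoundedlyInvertible (OpGraph.scalarAdd (l : ℂ) A) ∧
    ∀ x : X,
      IntegrableOn (fun t : ℝ => Real.exp (-(l * t)) • S t x) (Ioi 0) ∧
      OpGraph.resolvent A (l : ℂ) x = ∫ t in Ioi (0 : ℝ), Real.exp (-(l * t)) • S t x

/-- Convergence of a sequence of bounded operators in the strong operator topology. -/
def TendstoSOT (T : ℕ → X →L[ℂ] X) (T₀ : X →L[ℂ] X) : Prop :=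
  Tendsto (fun n => (ContinuousLinearMap.toPointwiseConvergenceCLM ℂ (RingHom.id ℂ) X X (T n)))
    atTop (𝓝 (ContinuousLinearMap.toPointwiseConvergenceCLM ℂ (RingHom.id ℂ) X X T₀))

/-- Convergence of a sequence of bounded operators in the weak operator topology. -/
def TendstoWOT (T : ℕ → X →L[ℂ] X) (T₀ : X →L[ℂ] X) : Prop :=
  Tendsto (fun n => ContinuousLinearMapWOT.ofCLM (T n)) atTop
    (𝓝 (ContinuousLinearMapWOT.ofCLM T₀))

/-- All the graphs `l I + A n` and `l I + A₀` are boundedly invertible. -/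
def ResolventsExist (A : ℕ → OpGraph X) (A₀ : OpGraph X) (l : ℂ) : Prop :=
  (∀ n, OpGraph.BoundedlyInvertible (OpGraph.scalarAdd l (A n))) ∧
    OpGraph.BoundedlyInvertible (OpGraph.scalarAdd l A₀)

/-- `(l I + A n)⁻¹ → (l I + A₀)⁻¹` in the strong operator topology (in particular, these inverses
exist as bounded operators). -/
def ResolventTendstoSOT (A : ℕ → OpGraph X) (A₀ : OpGraph X) (l : ℂ) : Prop :=
  ResolventsExist A A₀ l ∧
    TendstoSOT (fun n => OpGraph.resolvent (A n) l) (OpGraph.resolvent A₀ l)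

/-- `(l I + A n)⁻¹ → (l I + A₀)⁻¹` in the weak operator topology (in particular, these inverses
exist as bounded operators). -/
def ResolventTendstoWOT (A : ℕ → OpGraph X) (A₀ : OpGraph X) (l : ℂ) : Prop :=
  ResolventsExist A A₀ l ∧
    TendstoWOT (fun n => OpGraph.resolvent (A n) l) (OpGraph.resolvent A₀ l)

end Semigroup

end

/-! For a positive self-adjoint graph `A`, the operator `R = (I + A)⁻¹` is self-adjoint with
spectrum in `[0,1]`; its kernel is the multivalued part of `A`. The semigroup is a function of `R`:
`S t = φ_t(R)` with `φ_t(x) = exp(-t(1/x - 1))` and `φ_t(0) = 0` (`NegGenerates.eq_cfc_heatSymbol`),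
because both sides have the same Laplace transform. For `t > 0` the function `φ_t` is continuous on
`[0,1]`, so strong convergence of the `R n` passes to `φ_t(R n)` by polynomial approximation
(`tendsto_cfc_apply`). As `φ_t` is Lipschitz in `t ≥ δ` uniformly in `x`, the convergence is uniform
on `[δ,T]`. All the operators `S t` are contractions, so dominated convergence gives the integrated
statements.

The way back from weak to strong convergence goes through resolvents. Weak convergence together with
convergence of norms is strong convergence, and by the resolvent identity `‖R(l)f‖²` is a difference
quotient of weak quantities. For non-real `l` the points `l` and its conjugate suffice
(`ResolventTendstoWOT.tendstoSOT_of_im_ne_zero`). For real `l` the quotient degenerates, and nearby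
real points replace the conjugate (`resolventTendstoSOT_of_real_accumulation`). The weakest
semigroup statement, convergence of the integrals over `[0,T]`, yields weak resolvent convergence on
the positive axis after an integration by parts in the Laplace transform. -/

noncomputable section

/-! ### Resolvents of positive self-adjoint graphs -/

namespace OpGraph

section Resolvent

variable {H : Type*} [NormedAddCommGroup H] [InnerProductSpace ℂ H]

lemma sub_smul_resolvent_mem {A : OpGraph H} {l : ℂ} (h : BoundedlyInvertible (scalarAdd l A))
    (f : H) : (resolvent A l f, f - l • resolvent A l f) ∈ A := by
  rw [← mem_scalarAdd, mem_iff_boundedInverse h]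
  rfl

lemma eq_resolvent_of_mem {A : OpGraph H} {l : ℂ} (h : BoundedlyInvertible (scalarAdd l A))
    {u f : H} (hu : (u, f - l • u) ∈ A) : u = resolvent A l f := by
  rwa [← mem_scalarAdd, mem_iff_boundedInverse h] at hu

lemma re_mul_norm_sq_le {A : OpGraph H} (hA : Positive A) {l : ℂ} {u f : H}
    (hu : (u, f - l • u) ∈ A) : l.re * ‖u‖ ^ 2 ≤ (inner ℂ u f).re := by
  have h := (hA _ _ hu).1
  rw [inner_sub_right, inner_smul_right, inner_self_eq_norm_sq_to_K] at h
  have h2 : (l * ((‖u‖ : ℂ)) ^ 2).re = l.re * ‖u‖ ^ 2 := by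
    rw [← Complex.ofReal_pow, Complex.re_mul_ofReal]
  rw [Complex.sub_re] at h
  erw [h2] at h
  linarith

lemma norm_resolvent_le {A : OpGraph H} (hA : Positive A) {l : ℂ} (hl : 0 < l.re)
    (h : BoundedlyInvertible (scalarAdd l A)) : ‖resolvent A l‖ ≤ 1 / l.re := by
  refine ContinuousLinearMap.opNorm_le_bound _ (by positivity) fun f => ?_
  have h1 := re_mul_norm_sq_le hA (sub_smul_resolvent_mem h f)
  set u := resolvent A l f
  have h2 : (inner ℂ u f).re ≤ ‖u‖ * ‖f‖ := re_inner_le_norm (𝕜 := ℂ) u f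
  rcases (norm_nonneg u).eq_or_lt with h0 | h0
  · rw [← h0]; positivity
  · rw [one_div, ← div_eq_inv_mul, le_div_iff₀ hl]
    refine le_of_mul_le_mul_left ?_ h0
    nlinarith

/-- `R(m)f` solves the equation at `l` with right-hand side `f + (l - m)R(m)f`. -/
lemma resolvent_sub_resolvent {A : OpGraph H} {l m : ℂ} (hl : BoundedlyInvertible (scalarAdd l A))
    (hm : BoundedlyInvertible (scalarAdd m A)) :
    resolvent A l - resolvent A m = (m - l) • (resolvent A l * resolvent A m) := by
  ext f
  have h : resolvent A m f = resolvent A l (f + (l - m) • resolvent A m f) := by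
    refine eq_resolvent_of_mem hl ?_
    convert sub_smul_resolvent_mem hm f using 2
    module
  rw [map_add, map_smul] at h
  change resolvent A l f - resolvent A m f = (m - l) • resolvent A l (resolvent A m f)
  rw [sub_eq_iff_eq_add]
  nth_rewrite 2 [h]
  module

/-- Neumann series: `(u, f) ∈ mI + A` means `(1 - (l - m)R(l))u = R(l)f`. -/
lemma boundedlyInvertible_of_norm_lt_one [CompleteSpace H] {A : OpGraph H} {l m : ℂ}
    (hl : BoundedlyInvertible (scalarAdd l A)) (h : ‖(l - m) • resolvent A l‖ < 1) :
    BoundedlyInvertible (scalarAdd m A) := by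
  obtain ⟨V, hV⟩ := isUnit_one_sub_of_norm_lt_one h
  refine ⟨(↑V⁻¹ : H →L[ℂ] H) * resolvent A l, ?_⟩
  ext ⟨f, u⟩
  rw [mem_inverse, LinearMap.mem_graph_iff, mem_scalarAdd]
  have key : (u, f - m • u) ∈ A ↔ u = resolvent A l (f + (l - m) • u) := by
    rw [resolvent, ← mem_iff_boundedInverse hl, mem_scalarAdd]
    have : f + (l - m) • u - l • u = f - m • u := by module
    rw [this]
  rw [key, map_add, map_smul]
  have hVu : (V : H →L[ℂ] H) u = u - (l - m) • resolvent A l u := by rw [hV]; rfl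
  have e1 : u = resolvent A l f + (l - m) • resolvent A l u ↔
      (V : H →L[ℂ] H) u = resolvent A l f := by rw [hVu, sub_eq_iff_eq_add]
  rw [e1]
  constructor
  · intro h
    change u = (↑V⁻¹ : H →L[ℂ] H) (resolvent A l f)
    rw [← h]
    exact (DFunLike.congr_fun V.inv_mul u).symm
  · intro h
    change u = (↑V⁻¹ : H →L[ℂ] H) (resolvent A l f) at h
    rw [h]
    exact DFunLike.congr_fun V.mul_inv _

/-- Since `‖R(l)‖ ≤ 1/l`, the Neumann series covers the disc of radius `l` around `l`; these discs
exhaust the right half-plane as `l → ∞`. -/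
lemma boundedlyInvertible_of_re_pos [CompleteSpace H] {A : OpGraph H} (hA : Positive A) {ω : ℝ}
    (h : ∀ l : ℝ, ω < l → BoundedlyInvertible (scalarAdd (l : ℂ) A)) {m : ℂ} (hm : 0 < m.re) :
    BoundedlyInvertible (scalarAdd m A) := by
  -- The second entry gives `|l - m|² = l² - 2l Re m + |m|² ≤ l² - l Re m < l²`.
  set l : ℝ := max (ω + 1) (‖m‖ ^ 2 / m.re) with hl
  have hl1 : ω < l := lt_of_lt_of_le (by linarith) (le_max_left _ _)
  have hl2 : ‖m‖ ^ 2 / m.re ≤ l := le_max_right _ _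
  have hm0 : 0 < ‖m‖ := norm_pos_iff.2 fun h0 => by simp [h0] at hm
  have hl0 : 0 < l := lt_of_lt_of_le (by positivity) hl2
  refine boundedlyInvertible_of_norm_lt_one (h l hl1) ?_
  rw [norm_smul]
  have h1 : ‖resolvent A (l : ℂ)‖ ≤ 1 / l := norm_resolvent_le hA (by simpa using hl0) (h l hl1)
  have h2 : ‖(l : ℂ) - m‖ < l := by
    rw [← abs_of_pos hl0, ← abs_norm, ← sq_lt_sq, ← Complex.normSq_eq_norm_sq]
    rw [div_le_iff₀ hm, ← Complex.normSq_eq_norm_sq, Complex.normSq_apply] at hl2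
    simp only [abs_of_pos hl0, Complex.normSq_apply, Complex.sub_re, Complex.sub_im,
      Complex.ofReal_re, Complex.ofReal_im]
    nlinarith
  calc ‖(l : ℂ) - m‖ * ‖resolvent A (l : ℂ)‖ ≤ ‖(l : ℂ) - m‖ * (1 / l) := by gcongr
    _ < 1 := by rw [mul_one_div, div_lt_one hl0]; exact h2

lemma inner_resolvent_left {A : OpGraph H} (hA : SelfAdjoint A) {l : ℂ}
    (hl : BoundedlyInvertible (scalarAdd l A))
    (hl' : BoundedlyInvertible (scalarAdd (starRingEnd ℂ l) A)) (f g : H) :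
    inner ℂ (resolvent A l f) g = inner ℂ f (resolvent A (starRingEnd ℂ l) g) := by
  have h1 := sub_smul_resolvent_mem hl f
  have h2 := sub_smul_resolvent_mem hl' g
  replace h2 : (resolvent A (starRingEnd ℂ l) g,
      g - starRingEnd ℂ l • resolvent A (starRingEnd ℂ l) g) ∈ Submodule.adjoint A := by
    rwa [show Submodule.adjoint A = A from hA]
  rw [Submodule.mem_adjoint_iff] at h2
  have h3 := h2 _ _ h1
  simp only [inner_sub_left, inner_sub_right, inner_smul_left, inner_smul_right] at h3
  linear_combination -h3

lemma adjoint_resolvent [CompleteSpace H] {A : OpGraph H} (hA : SelfAdjoint A) {l : ℂ}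
    (hl : BoundedlyInvertible (scalarAdd l A))
    (hl' : BoundedlyInvertible (scalarAdd (starRingEnd ℂ l) A)) :
    ContinuousLinearMap.adjoint (resolvent A l) = resolvent A (starRingEnd ℂ l) := by
  refine (ContinuousLinearMap.eq_adjoint_iff _ _).2 (fun f g => ?_) |>.symm
  have := inner_resolvent_left hA hl' (by simpa using hl) f g
  simpa using this

lemma isSelfAdjoint_resolvent_ofReal [CompleteSpace H] {A : OpGraph H} (hA : SelfAdjoint A) {l : ℝ}
    (hl : BoundedlyInvertible (scalarAdd (l : ℂ) A)) : IsSelfAdjoint (resolvent A (l : ℂ)) := by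
  have := adjoint_resolvent hA hl (by simpa using hl)
  rw [Complex.conj_ofReal] at this
  exact this

lemma spectrum_resolvent_one_subset [CompleteSpace H] {A : OpGraph H} (hA : SelfAdjoint A)
    (hP : Positive A) (h : BoundedlyInvertible (scalarAdd 1 A)) :
    spectrum ℝ (resolvent A 1) ⊆ Icc 0 1 := by
  have hsa : IsSelfAdjoint (resolvent A 1) := by
    have := isSelfAdjoint_resolvent_ofReal hA (l := 1) (by simpa using h)
    simpa using this
  have hpos : 0 ≤ resolvent A 1 := by
    rw [ContinuousLinearMap.nonneg_iff_isPositive, ContinuousLinearMap.isPositive_def']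
    refine ⟨hsa, fun f => ?_⟩
    have := re_mul_norm_sq_le hP (sub_smul_resolvent_mem h f)
    rw [ContinuousLinearMap.reApplyInnerSelf]
    refine le_trans ?_ this
    rw [Complex.one_re]
    positivity
  intro x hx
  refine ⟨spectrum_nonneg_of_nonneg hpos hx, ?_⟩
  have h1 : ‖resolvent A 1‖ ≤ 1 := by simpa using norm_resolvent_le hP (by simp) h
  -- Bounding the spectrum by the norm uses `‖1‖ = 1`, which fails on the zero space; there the
  -- spectrum is empty.
  rcases subsingleton_or_nontrivial H with hH | hH
  · have : Subsingleton (H →L[ℂ] H) := ⟨fun a b => by ext v; exact Subsingleton.elim _ _⟩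
    simp [spectrum.of_subsingleton] at hx
  · exact (le_abs_self x).trans ((spectrum.norm_le_norm_of_mem hx).trans h1)

end Resolvent

end OpGraph

/-! ### The symbol of the semigroup -/

/-- The function `x ↦ exp (-t (1 / x - 1))`, which sends the resolvent at `1` of a positive
self-adjoint graph to the semigroup at time `t`. -/
def heatSymbol (t x : ℝ) : ℝ := if x = 0 then 0 else Real.exp (-(t * (x⁻¹ - 1)))

lemma heatSymbol_nonneg (t x : ℝ) : 0 ≤ heatSymbol t x := by
  unfold heatSymbol; split_ifs <;> positivity

lemma inv_sub_one_nonneg {x : ℝ} (hx : x ∈ Icc (0 : ℝ) 1) (h0 : x ≠ 0) : 0 ≤ x⁻¹ - 1 := by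
  have h : 0 < x := lt_of_le_of_ne hx.1 h0.symm
  rw [sub_nonneg]
  exact (one_le_inv₀ h).2 hx.2

lemma heatSymbol_le_one {t x : ℝ} (ht : 0 < t) (hx : x ∈ Icc (0 : ℝ) 1) : heatSymbol t x ≤ 1 := by
  unfold heatSymbol
  split_ifs with h
  · exact zero_le_one
  · have := inv_sub_one_nonneg hx h
    rw [Real.exp_le_one_iff]
    nlinarith

/-- This is `exp(-y) ≤ 1/(1 + y)` with `y = t(1/x - 1)`. The bound is continuous and vanishes at `x
= 0`, which settles joint continuity of the symbol there. -/
lemma heatSymbol_le_div {t x : ℝ} (ht : 0 < t) (hx : x ∈ Icc (0 : ℝ) 1) :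
    heatSymbol t x ≤ x / (x + t * (1 - x)) := by
  unfold heatSymbol
  split_ifs with h
  · simp [h]
  · have h0 : 0 < x := lt_of_le_of_ne hx.1 (Ne.symm h)
    have h1 := inv_sub_one_nonneg hx h
    have h2 : x / (x + t * (1 - x)) = (1 + t * (x⁻¹ - 1))⁻¹ := by
      have : 0 ≤ t * (1 - x) := mul_nonneg ht.le (by linarith [hx.2])
      field_simp
    rw [h2, Real.exp_neg]
    gcongr
    linarith [Real.add_one_le_exp (t * (x⁻¹ - 1))]

lemma continuousOn_uncurry_heatSymbol :
    ContinuousOn (Function.uncurry heatSymbol) (Ioi 0 ×ˢ Icc 0 1) := by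
  rintro ⟨t, x⟩ ⟨ht, hx⟩
  rw [mem_Ioi] at ht
  by_cases h : x = 0
  · subst h
    have hd : ContinuousAt (fun p : ℝ × ℝ => p.2 / (p.2 + p.1 * (1 - p.2))) (t, 0) := by
      refine ContinuousAt.div (by fun_prop) (by fun_prop) ?_
      simpa using ht.ne'
    have hd' := hd.continuousWithinAt (s := Ioi 0 ×ˢ Icc 0 1)
    have e : Function.uncurry heatSymbol (t, 0) = 0 := by simp [heatSymbol]
    rw [ContinuousWithinAt, e]
    rw [ContinuousWithinAt] at hd'
    simp only [zero_div] at hd'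
    refine tendsto_of_tendsto_of_tendsto_of_le_of_le' tendsto_const_nhds hd' ?_ ?_
    · exact .of_forall fun p => heatSymbol_nonneg _ _
    · filter_upwards [self_mem_nhdsWithin] with p hp using heatSymbol_le_div hp.1 hp.2
  · refine ContinuousAt.continuousWithinAt ?_
    have h1 : ContinuousAt (fun p : ℝ × ℝ => Real.exp (-(p.1 * (p.2⁻¹ - 1)))) (t, x) := by
      have : ContinuousAt (fun p : ℝ × ℝ => p.2⁻¹) (t, x) :=
        ContinuousAt.inv₀ (by fun_prop) h
      fun_prop
    refine h1.congr ?_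
    have : ∀ᶠ p : ℝ × ℝ in 𝓝 (t, x), p.2 ≠ 0 :=
      (continuous_snd.continuousAt (x := (t, x))).eventually_ne h
    filter_upwards [this] with p hp
    simp [Function.uncurry, heatSymbol, hp]

lemma continuousOn_heatSymbol {t : ℝ} (ht : 0 < t) : ContinuousOn (heatSymbol t) (Icc 0 1) :=
  continuousOn_uncurry_heatSymbol.comp (f := fun x => (t, x)) (by fun_prop)
    fun _ hx => ⟨ht, hx⟩

/-- The constant is independent of `x` because `y exp(-sy) ≤ 1/s ≤ 1/δ` for `y = 1/x - 1 ≥ 0`. -/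
lemma abs_heatSymbol_sub_le {δ s t x : ℝ} (hδ : 0 < δ) (hs : δ ≤ s) (hst : s ≤ t)
    (hx : x ∈ Icc (0 : ℝ) 1) : |heatSymbol t x - heatSymbol s x| ≤ (t - s) / δ := by
  unfold heatSymbol
  split_ifs with h
  · simpa using div_nonneg (sub_nonneg.2 hst) hδ.le
  · have hy := inv_sub_one_nonneg hx h
    set y := x⁻¹ - 1
    have h1 : Real.exp (-(t * y)) ≤ Real.exp (-(s * y)) := by
      rw [Real.exp_le_exp]; nlinarith
    rw [abs_sub_comm, abs_of_nonneg (sub_nonneg.2 h1)]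
    have h2 : Real.exp (-(t * y)) = Real.exp (-(s * y)) * Real.exp (-((t - s) * y)) := by
      rw [← Real.exp_add]; ring_nf
    have h3 := Real.add_one_le_exp (-((t - s) * y))
    have h4 : Real.exp (-(s * y)) * (δ * y) ≤ 1 := by
      rw [Real.exp_neg, inv_mul_le_iff₀ (Real.exp_pos _), mul_one]
      nlinarith [Real.add_one_le_exp (s * y)]
    rw [h2, le_div_iff₀ hδ]
    have h5 : Real.exp (-(s * y)) - Real.exp (-(s * y)) * Real.exp (-((t - s) * y))
        ≤ Real.exp (-(s * y)) * ((t - s) * y) := by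
      have := Real.exp_pos (-(s * y))
      nlinarith
    calc _ ≤ Real.exp (-(s * y)) * ((t - s) * y) * δ := by gcongr
      _ = (t - s) * (Real.exp (-(s * y)) * (δ * y)) := by ring
      _ ≤ (t - s) * 1 := by gcongr
      _ = t - s := mul_one _

lemma laplace_heatSymbol {l x : ℝ} (hl : 0 < l) (hx : x ∈ Icc (0 : ℝ) 1) :
    ∫ t in Ioi (0 : ℝ), Real.exp (-(l * t)) * heatSymbol t x = x / (1 + (l - 1) * x) := by
  unfold heatSymbol
  split_ifs with h
  · simp [h]
  · have h0 : 0 < x := lt_of_le_of_ne hx.1 (Ne.symm h)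
    have hy := inv_sub_one_nonneg hx h
    have e : ∀ t : ℝ, Real.exp (-(l * t)) * Real.exp (-(t * (x⁻¹ - 1))) =
        Real.exp (-(l + (x⁻¹ - 1)) * t) := fun t => by rw [← Real.exp_add]; ring_nf
    simp_rw [e]
    rw [integral_exp_mul_Ioi (by linarith)]
    have h1 : 0 < 1 + (l - 1) * x := by nlinarith [hx.2]
    have h2 : l + (x⁻¹ - 1) ≠ 0 := by positivity
    simp only [mul_zero, Real.exp_zero]
    field_simp
    ring

/-! ### Uniqueness for Laplace transforms -/

/-- Injectivity of the Laplace transform on functions that are continuous on `(0, ∞)`. -/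
theorem eqOn_zero_of_laplace_eq_zero {E : Type*} [NormedAddCommGroup E] [NormedSpace ℝ E]
    [CompleteSpace E] {h : ℝ → E} (hc : ContinuousOn h (Ioi 0)) {ω : ℝ}
    (hi : ∀ l, ω < l → IntegrableOn (fun t => Real.exp (-(l * t)) • h t) (Ioi 0))
    (h0 : ∀ l, ω < l → ∫ t in Ioi (0 : ℝ), Real.exp (-(l * t)) • h t = 0) :
    ∀ t, 0 < t → h t = 0 := by
  -- Only the points `c + n` are used: vanishing there says that `k` is orthogonal to every
  -- polynomial in `exp(-t)`.
  set c := ω + 1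
  set k : ℝ → E := fun t => Real.exp (-(c * t)) • h t with hk
  have hkint : IntegrableOn k (Ioi 0) := hi c (by simp [c])
  have hexp : ∀ t > (0 : ℝ), Real.exp (-t) ∈ Icc (0 : ℝ) 1 := fun t ht =>
    ⟨(Real.exp_pos _).le, by rw [Real.exp_le_one_iff]; linarith⟩
  have hmono : ∀ n : ℕ, IntegrableOn (fun t => (Real.exp (-t)) ^ n • k t) (Ioi 0) ∧
      ∫ t in Ioi (0 : ℝ), (Real.exp (-t)) ^ n • k t = 0 := by
    intro n
    have e : (fun t => (Real.exp (-t)) ^ n • k t) =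
        fun t => Real.exp (-((c + n) * t)) • h t := by
      funext t
      rw [hk, ← Real.exp_nat_mul]
      simp only [smul_smul, ← Real.exp_add]
      ring_nf
    have hn : ω < c + n := by
      have : (0 : ℝ) ≤ n := n.cast_nonneg
      simp only [c]; linarith
    rw [e]
    exact ⟨hi _ hn, h0 _ hn⟩
  have hpoly : ∀ p : Polynomial ℝ, IntegrableOn (fun t => p.eval (Real.exp (-t)) • k t) (Ioi 0) ∧
      ∫ t in Ioi (0 : ℝ), p.eval (Real.exp (-t)) • k t = 0 := by
    intro p
    simp_rw [Polynomial.eval_eq_sum_range, Finset.sum_smul, mul_smul]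
    have hint : ∀ i ∈ Finset.range (p.natDegree + 1), IntegrableOn
        (fun t => p.coeff i • Real.exp (-t) ^ i • k t) (Ioi 0) := fun i _ => (hmono i).1.smul _
    refine ⟨integrable_finsetSum _ hint, ?_⟩
    rw [integral_finsetSum _ hint]
    refine Finset.sum_eq_zero fun i _ => ?_
    rw [integral_smul, (hmono i).2, smul_zero]
  have hkc : ContinuousOn k (Ioi 0) :=
    ContinuousOn.smul (by fun_prop) hc
  have hzero : ∀ φ : ℝ → ℝ, Continuous φ → HasCompactSupport φ → tsupport φ ⊆ Ioi 0 →
      ∫ t in Ioi (0 : ℝ), φ t • k t = 0 := by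
    intro φ hφ hφc hφs
    -- In the variable `x = exp(-t)` the test function is continuous up to `x = 0`: compact support
    -- gives the limit `0`, and the convention `log 0 = 0` gives the value `φ 0 = 0`. Weierstrass
    -- approximation then applies.
    have hψ : ContinuousOn (fun x => φ (-Real.log x)) (Icc 0 1) := by
      intro x _
      refine ContinuousAt.continuousWithinAt ?_
      rcases eq_or_ne x 0 with rfl | hx
      · have hφ0 : φ (-Real.log 0) = 0 := by
          rw [Real.log_zero, neg_zero]
          exact image_eq_zero_of_notMem_tsupport fun h => lt_irrefl (0 : ℝ) (hφs h)
        rw [continuousAt_iff_punctured_nhds, hφ0]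
        have h1 : Tendsto (fun x => -Real.log x) (𝓝[≠] 0) (cocompact ℝ) :=
          (tendsto_neg_atBot_atTop.comp Real.tendsto_log_nhdsNE_zero).mono_right
            atTop_le_cocompact
        exact (hφc.is_zero_at_infty.comp h1)
      · exact (hφ.continuousAt.comp (Real.continuousAt_log hx).neg)
    have hI : ∀ t ∈ Ioi (0 : ℝ), φ t = φ (-Real.log (Real.exp (-t))) := fun t _ => by simp
    rw [← norm_le_zero_iff]
    refine le_of_forall_pos_le_add fun ε hε => ?_
    set M := ∫ t in Ioi (0 : ℝ), ‖k t‖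
    have hM : 0 ≤ M := integral_nonneg fun _ => norm_nonneg _
    obtain ⟨p, hp⟩ := exists_polynomial_near_of_continuousOn 0 1 _ hψ (ε / (M + 1))
      (by positivity)
    have hφk : IntegrableOn (fun t => φ t • k t) (Ioi 0) := by
      obtain ⟨C, hC⟩ := hφc.exists_bound_of_continuous hφ
      exact hkint.bdd_smul C hφ.aestronglyMeasurable (.of_forall hC)
    have e : ∫ t in Ioi (0 : ℝ), φ t • k t =
        ∫ t in Ioi (0 : ℝ), (φ t • k t - p.eval (Real.exp (-t)) • k t) := by
      rw [integral_sub hφk (hpoly p).1, (hpoly p).2, sub_zero]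
    rw [e, zero_add]
    calc _ ≤ ∫ t in Ioi (0 : ℝ), ε / (M + 1) * ‖k t‖ := by
          refine norm_integral_le_of_norm_le (hkint.norm.const_mul _) ?_
          refine ae_restrict_of_forall_mem measurableSet_Ioi fun t ht => ?_
          rw [← sub_smul, norm_smul, Real.norm_eq_abs, abs_sub_comm, hI t ht]
          gcongr
          exact (hp _ (hexp t ht)).le
      _ = ε / (M + 1) * M := integral_const_mul _ _
      _ ≤ ε := by
          rw [div_mul_eq_mul_div, div_le_iff₀ (by positivity)]
          nlinarith
  have hae : ∀ᵐ t : ℝ, t ∈ Ioi (0 : ℝ) → k t = 0 := by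
    refine isOpen_Ioi.ae_eq_zero_of_integral_contDiff_smul_eq_zero
      (hkc.locallyIntegrableOn measurableSet_Ioi) fun φ hφ hφc hφs => ?_
    rw [← hzero φ hφ.continuous hφc hφs, setIntegral_eq_integral_of_forall_compl_eq_zero]
    intro t ht
    rw [image_eq_zero_of_notMem_tsupport fun h => ht (hφs h), zero_smul]
  have hae' : k =ᵐ[volume.restrict (Ioi 0)] 0 := by
    rw [EventuallyEq, ae_restrict_iff' measurableSet_Ioi]
    exact hae
  have := Measure.eqOn_open_of_ae_eq hae' isOpen_Ioi hkc continuousOn_const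
  intro t ht
  have h1 : Real.exp (-(c * t)) • h t = 0 := this ht
  exact (smul_eq_zero.1 h1).resolve_left (Real.exp_pos _).ne'

/-! ### The semigroup as a function of the resolvent -/

section Representation

variable {H : Type*} [NormedAddCommGroup H] [InnerProductSpace ℂ H] [CompleteSpace H]

namespace NegGenerates

variable {A : OpGraph H} {S : ℝ → H →L[ℂ] H}

lemma boundedlyInvertible (h : NegGenerates A S) (hP : A.Positive) {l : ℂ} (hl : 0 < l.re) :
    (OpGraph.scalarAdd l A).BoundedlyInvertible := by
  obtain ⟨-, ω, hω⟩ := h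
  exact OpGraph.boundedlyInvertible_of_re_pos hP (fun r hr => (hω r hr).1) hl

lemma norm_resolvent_le (h : NegGenerates A S) (hP : A.Positive) {l : ℂ} (hl : 0 < l.re) :
    ‖A.resolvent l‖ ≤ 1 / l.re :=
  OpGraph.norm_resolvent_le hP hl (h.boundedlyInvertible hP hl)

lemma isSelfAdjoint_resolvent_one (h : NegGenerates A S) (hA : A.SelfAdjoint ∧ A.Positive) :
    IsSelfAdjoint (A.resolvent 1) := by
  have := OpGraph.isSelfAdjoint_resolvent_ofReal (l := 1) hA.1
    (h.boundedlyInvertible hA.2 (by simp))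
  simpa using this

lemma spectrum_resolvent_one_subset (h : NegGenerates A S) (hA : A.SelfAdjoint ∧ A.Positive) :
    spectrum ℝ (A.resolvent 1) ⊆ Icc 0 1 :=
  OpGraph.spectrum_resolvent_one_subset hA.1 hA.2 (h.boundedlyInvertible hA.2 (by simp))

/-- The resolvent identity reads `R(l)(1 + (l - 1)R) = R`, and the factor `1 + (l - 1)x = (1 - x) +
lx` is positive on `[0,1]`. -/
lemma resolvent_ofReal_eq_cfc (h : NegGenerates A S) (hA : A.SelfAdjoint ∧ A.Positive) {l : ℝ}
    (hl : 0 < l) :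
    A.resolvent (l : ℂ) = cfc (fun x : ℝ => x / (1 + (l - 1) * x)) (A.resolvent 1) := by
  have hsa := h.isSelfAdjoint_resolvent_one hA
  have hσ := h.spectrum_resolvent_one_subset hA
  set R := A.resolvent 1 with hR
  have hpos : ∀ x ∈ spectrum ℝ R, 1 + (l - 1) * x ≠ 0 := fun x hx => by
    have := hσ hx
    have : 0 < 1 + (l - 1) * x := by
      rcases this.1.eq_or_lt with h0 | h0
      · simp [← h0]
      · nlinarith [this.2, mul_pos hl h0]
    exact this.ne'
  have hc : ContinuousOn (fun x : ℝ => (1 + (l - 1) * x)⁻¹) (spectrum ℝ R) :=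
    ContinuousOn.inv₀ (by fun_prop) hpos
  have hg : cfc (fun x : ℝ => 1 + (l - 1) * x) R = 1 + (l - 1) • R := by
    rw [cfc_add .., cfc_const_mul .., cfc_id' .., cfc_const_one ..]
  have hinv : cfc (fun x : ℝ => 1 + (l - 1) * x) R *
      cfc (fun x : ℝ => (1 + (l - 1) * x)⁻¹) R = 1 := by
    rw [← cfc_mul _ _ R (by fun_prop) hc, ← cfc_const_one ℝ R]
    exact cfc_congr fun x hx => mul_inv_cancel₀ (hpos x hx)
  have hid : A.resolvent (l : ℂ) * (1 + (l - 1) • R) = R := by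
    have := OpGraph.resolvent_sub_resolvent (h.boundedlyInvertible hA.2 (l := l) (by simpa))
      (h.boundedlyInvertible hA.2 (l := 1) (by simp))
    rw [← hR, show ((1 : ℂ) - (l : ℂ)) = ((1 - l : ℝ) : ℂ) by push_cast; ring] at this
    rw [mul_add, mul_one, mul_smul_comm]
    have e : ((1 - l : ℝ) : ℂ) • (A.resolvent (l : ℂ) * R) =
        (1 - l) • (A.resolvent (l : ℂ) * R) := by
      ext f; exact Complex.coe_smul _ _
    rw [e] at this
    rw [← sub_eq_zero]
    have e2 : A.resolvent (l : ℂ) + (l - 1) • (A.resolvent (l : ℂ) * R) - R =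
      (A.resolvent (l : ℂ) - R) + (l - 1) • (A.resolvent (l : ℂ) * R) := by abel
    rw [e2, this, ← add_smul]
    simp
  calc A.resolvent (l : ℂ)
      = A.resolvent (l : ℂ) * (cfc (fun x : ℝ => 1 + (l - 1) * x) R *
          cfc (fun x : ℝ => (1 + (l - 1) * x)⁻¹) R) := by rw [hinv, mul_one]
    _ = R * cfc (fun x : ℝ => (1 + (l - 1) * x)⁻¹) R := by rw [← mul_assoc, hg, hid]
    _ = cfc (fun x : ℝ => x) R * cfc (fun x : ℝ => (1 + (l - 1) * x)⁻¹) R := by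
      rw [cfc_id' ..]
    _ = _ := by
      rw [← cfc_mul _ _ R (by fun_prop) hc]
      rfl

/-- The functional calculus commutes with the integral, which is dominated by `exp(-lt)`; this
reduces the claim to the scalar `laplace_heatSymbol`. -/
lemma laplace_cfc_heatSymbol (h : NegGenerates A S) (hA : A.SelfAdjoint ∧ A.Positive) {l : ℝ}
    (hl : 0 < l) (f : H) :
    IntegrableOn (fun t : ℝ => Real.exp (-(l * t)) • cfc (heatSymbol t) (A.resolvent 1) f)
      (Ioi 0) ∧
    ∫ t in Ioi (0 : ℝ), Real.exp (-(l * t)) • cfc (heatSymbol t) (A.resolvent 1) f =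
      A.resolvent (l : ℂ) f := by
  have hsa := h.isSelfAdjoint_resolvent_one hA
  have hσ := h.spectrum_resolvent_one_subset hA
  rw [h.resolvent_ofReal_eq_cfc hA hl]
  set R := A.resolvent 1
  have hc : ContinuousOn (Function.uncurry fun t x : ℝ => Real.exp (-(l * t)) * heatSymbol t x)
      (Ioi 0 ×ˢ spectrum ℝ R) := by
    have h1 := continuousOn_uncurry_heatSymbol.mono (Set.prod_mono (Subset.refl (Ioi (0 : ℝ))) hσ)
    exact ContinuousOn.mul (f := fun p : ℝ × ℝ => Real.exp (-(l * p.1))) (by fun_prop) h1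
  have hb : ∀ᵐ t ∂(volume.restrict (Ioi (0 : ℝ))), ∀ x ∈ spectrum ℝ R,
      ‖Real.exp (-(l * t)) * heatSymbol t x‖ ≤ Real.exp (-l * t) := by
    refine ae_restrict_of_forall_mem measurableSet_Ioi fun t ht x hx => ?_
    rw [norm_mul, Real.norm_eq_abs, Real.norm_eq_abs, abs_of_pos (Real.exp_pos _),
      abs_of_nonneg (heatSymbol_nonneg _ _), neg_mul]
    exact mul_le_of_le_one_right (Real.exp_pos _).le (heatSymbol_le_one ht (hσ hx))
  have hbi : HasFiniteIntegral (fun t => Real.exp (-l * t)) (volume.restrict (Ioi (0 : ℝ))) :=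
    (integrableOn_exp_mul_Ioi (by linarith) 0).2
  have e : ∀ t ∈ Ioi (0 : ℝ), cfc (fun x => Real.exp (-(l * t)) * heatSymbol t x) R =
      Real.exp (-(l * t)) • cfc (heatSymbol t) R := fun t ht =>
    cfc_const_mul _ _ R ((continuousOn_heatSymbol ht).mono hσ)
  have hint := integrableOn_cfc measurableSet_Ioi _ _ R hc hb hbi hsa
  have hval := cfc_setIntegral measurableSet_Ioi _ _ R hc hb hbi hsa
  have hint' : IntegrableOn (fun t => Real.exp (-(l * t)) • cfc (heatSymbol t) R) (Ioi 0) :=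
    hint.congr_fun e measurableSet_Ioi
  refine ⟨(ContinuousLinearMap.apply ℂ H f).integrable_comp hint', ?_⟩
  have h2 := ContinuousLinearMap.integral_apply hint' f
  rw [← setIntegral_congr_fun measurableSet_Ioi e, ← hval] at h2
  refine (Eq.trans ?_ h2.symm).trans ?_
  · rfl
  · congr 1
    exact cfc_congr fun x hx => laplace_heatSymbol hl (hσ hx)

theorem eq_cfc_heatSymbol (h : NegGenerates A S) (hA : A.SelfAdjoint ∧ A.Positive) {t : ℝ}
    (ht : 0 < t) : S t = cfc (heatSymbol t) (A.resolvent 1) := by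
  have hsa := h.isSelfAdjoint_resolvent_one hA
  have hσ := h.spectrum_resolvent_one_subset hA
  ext f
  obtain ⟨hS, ω, hω⟩ := id h
  -- The Lipschitz bound with `δ = t/2` gives continuity at `t`, even in operator norm.
  have hcont : ContinuousOn (fun t => cfc (heatSymbol t) (A.resolvent 1) f) (Ioi 0) := by
    refine ContinuousOn.clm_apply ?_ continuousOn_const
    intro t ht
    rw [mem_Ioi] at ht
    refine ContinuousAt.continuousWithinAt ?_
    rw [ContinuousAt, tendsto_iff_norm_sub_tendsto_zero]
    have hlim : Tendsto (fun s => |s - t| / (t / 2)) (𝓝 t) (𝓝 0) := by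
      have : ContinuousAt (fun s => |s - t| / (t / 2)) t := by fun_prop
      simpa [ContinuousAt] using this
    refine squeeze_zero' (.of_forall fun _ => norm_nonneg _) ?_ hlim
    filter_upwards [lt_mem_nhds (show t / 2 < t by linarith)] with s hs
    have hs0 : 0 < s := by linarith
    rw [← cfc_sub _ _ _ ((continuousOn_heatSymbol hs0).mono hσ)
      ((continuousOn_heatSymbol ht).mono hσ)]
    refine norm_cfc_le (by positivity) fun x hx => ?_
    rw [Real.norm_eq_abs]
    rcases le_total s t with hst | hst
    · rw [abs_sub_comm, abs_sub_comm s, abs_of_nonneg (sub_nonneg.2 hst)]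
      exact abs_heatSymbol_sub_le (by linarith) hs.le hst (hσ hx)
    · rw [abs_of_nonneg (sub_nonneg.2 hst)]
      exact abs_heatSymbol_sub_le (by linarith) (by linarith) hst (hσ hx)
  rw [← sub_eq_zero]
  refine eqOn_zero_of_laplace_eq_zero
    (h := fun t => S t f - cfc (heatSymbol t) (A.resolvent 1) f)
    ((hS.continuousOn f).sub hcont) (ω := max ω 0) ?_ ?_ t ht
  · intro l hl
    simp_rw [smul_sub]
    exact ((hω l (lt_of_le_of_lt (le_max_left _ _) hl)).2 f).1.sub
      (h.laplace_cfc_heatSymbol hA (lt_of_le_of_lt (le_max_right _ _) hl) f).1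
  · intro l hl
    simp_rw [smul_sub]
    obtain ⟨i1, e1⟩ := (hω l (lt_of_le_of_lt (le_max_left _ _) hl)).2 f
    obtain ⟨i2, e2⟩ := h.laplace_cfc_heatSymbol hA (lt_of_le_of_lt (le_max_right _ _) hl) f
    rw [integral_sub i1 i2, ← e1, e2, sub_self]

lemma norm_le_one (h : NegGenerates A S) (hA : A.SelfAdjoint ∧ A.Positive) {t : ℝ}
    (ht : 0 < t) : ‖S t‖ ≤ 1 := by
  rw [h.eq_cfc_heatSymbol hA ht]
  refine norm_cfc_le zero_le_one fun x hx => ?_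
  rw [Real.norm_eq_abs, abs_of_nonneg (heatSymbol_nonneg _ _)]
  exact heatSymbol_le_one ht (h.spectrum_resolvent_one_subset hA hx)

lemma norm_apply_le (h : NegGenerates A S) (hA : A.SelfAdjoint ∧ A.Positive) {t : ℝ}
    (ht : 0 < t) (f : H) : ‖S t f‖ ≤ ‖f‖ := by
  simpa using (S t).le_of_opNorm_le (h.norm_le_one hA ht) f

lemma norm_sub_le (h : NegGenerates A S) (hA : A.SelfAdjoint ∧ A.Positive) {δ s t : ℝ}
    (hδ : 0 < δ) (hs : δ ≤ s) (hst : s ≤ t) : ‖S t - S s‖ ≤ (t - s) / δ := by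
  have hσ := h.spectrum_resolvent_one_subset hA
  have hs0 : 0 < s := by linarith
  have ht0 : 0 < t := by linarith
  rw [h.eq_cfc_heatSymbol hA ht0, h.eq_cfc_heatSymbol hA hs0,
    ← cfc_sub _ _ _ ((continuousOn_heatSymbol ht0).mono hσ)
      ((continuousOn_heatSymbol hs0).mono hσ)]
  exact norm_cfc_le (div_nonneg (by linarith) hδ.le) fun x hx =>
    abs_heatSymbol_sub_le hδ hs hst (hσ hx)

/-- Generation provides this only beyond some `ω`, which may vary along a sequence of graphs; here
every `l > 0` is admissible. -/
lemma laplace_eq_resolvent (h : NegGenerates A S) (hA : A.SelfAdjoint ∧ A.Positive) {l : ℝ}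
    (hl : 0 < l) (f : H) :
    IntegrableOn (fun t : ℝ => Real.exp (-(l * t)) • S t f) (Ioi 0) ∧
    ∫ t in Ioi (0 : ℝ), Real.exp (-(l * t)) • S t f = A.resolvent (l : ℂ) f := by
  have e : EqOn (fun t : ℝ => Real.exp (-(l * t)) • cfc (heatSymbol t) (A.resolvent 1) f)
      (fun t => Real.exp (-(l * t)) • S t f) (Ioi 0) := fun t ht => by
    simp only [h.eq_cfc_heatSymbol hA ht]
  obtain ⟨i, v⟩ := h.laplace_cfc_heatSymbol hA hl f
  exact ⟨i.congr_fun e measurableSet_Ioi, (setIntegral_congr_fun measurableSet_Ioi e).symm.trans v⟩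

end NegGenerates

end Representation

/-! ### Laplace transforms and primitives -/

/-- Integration by parts for the Laplace transform of a bounded function. -/
theorem laplace_eq_mul_laplace_primitive {E : Type*} [NormedAddCommGroup E] [NormedSpace ℝ E]
    [CompleteSpace E] {h : ℝ → E} (hc : ContinuousOn h (Ioi 0)) {C : ℝ}
    (hC : ∀ t, 0 < t → ‖h t‖ ≤ C) {l : ℝ} (hl : 0 < l) :
    ∫ t in Ioi (0 : ℝ), Real.exp (-(l * t)) • h t =
      l • ∫ t in Ioi (0 : ℝ), Real.exp (-(l * t)) • ∫ s in (0 : ℝ)..t, h s := by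
  have hC0 : 0 ≤ C := (norm_nonneg _).trans (hC 1 one_pos)
  set P : ℝ → E := fun t => ∫ s in (0 : ℝ)..t, h s
  have hmeas := hc.aestronglyMeasurable measurableSet_Ioi (μ := volume)
  have hii : ∀ t, 0 ≤ t → IntervalIntegrable h volume 0 t := fun t ht => by
    rw [intervalIntegrable_iff_integrableOn_Ioc_of_le ht]
    refine (integrable_const C).mono' (hmeas.mono_set Ioc_subset_Ioi_self) ?_
    exact ae_restrict_of_forall_mem measurableSet_Ioc fun s hs => hC s hs.1
  have hP : ∀ t, 0 < t → ‖P t‖ ≤ C * t := fun t ht => by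
    have := intervalIntegral.norm_integral_le_of_norm_le_const (a := 0) (b := t) (C := C) (f := h)
      fun s hs => hC s (by rw [uIoc_of_le ht.le] at hs; exact hs.1)
    simpa [abs_of_pos ht] using this
  have hder : ∀ t, 0 < t → HasDerivAt P (h t) t := fun t ht =>
    intervalIntegral.integral_hasDerivAt_right (hii t ht.le)
      ⟨Ioi 0, Ioi_mem_nhds ht, hmeas⟩ (hc.continuousAt (Ioi_mem_nhds ht))
  have hPc : ContinuousOn P (Ioi 0) := fun t ht => (hder t ht).continuousAt.continuousWithinAt
  -- Half of the exponential decay absorbs the linear growth of the primitive.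
  have hte : ∀ t : ℝ, Real.exp (-(l * t)) * t ≤ 2 / l * Real.exp (-(l / 2) * t) := fun t => by
    have h1 := Real.add_one_le_exp (l / 2 * t)
    have h2 : Real.exp (-(l / 2) * t) = Real.exp (-(l * t)) * Real.exp (l / 2 * t) := by
      rw [← Real.exp_add]; ring_nf
    have h3 : t ≤ 2 / l * Real.exp (l / 2 * t) := by
      rw [div_mul_eq_mul_div, le_div_iff₀ hl]; linarith
    rw [h2]
    calc _ ≤ Real.exp (-(l * t)) * (2 / l * Real.exp (l / 2 * t)) := by gcongr
      _ = _ := by ring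
  have hi1 : IntegrableOn (fun t => Real.exp (-(l * t)) • h t) (Ioi 0) := by
    refine ((integrableOn_exp_mul_Ioi (a := -l) (by linarith) 0).mul_const C).mono'
      ((ContinuousOn.smul (by fun_prop) hc).aestronglyMeasurable measurableSet_Ioi) ?_
    refine ae_restrict_of_forall_mem measurableSet_Ioi fun t ht => ?_
    rw [norm_smul, Real.norm_eq_abs, abs_of_pos (Real.exp_pos _), neg_mul]
    gcongr
    exact hC t ht
  have hb2 : ∀ t, 0 < t → ‖Real.exp (-(l * t)) • P t‖ ≤
      C * (2 / l) * Real.exp (-(l / 2) * t) := fun t ht => by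
    rw [norm_smul, Real.norm_eq_abs, abs_of_pos (Real.exp_pos _)]
    calc _ ≤ Real.exp (-(l * t)) * (C * t) := by gcongr; exact hP t ht
      _ = C * (Real.exp (-(l * t)) * t) := by ring
      _ ≤ C * (2 / l * Real.exp (-(l / 2) * t)) := by exact mul_le_mul_of_nonneg_left (hte t) hC0
      _ = _ := by ring
  have hi2 : IntegrableOn (fun t => Real.exp (-(l * t)) • P t) (Ioi 0) := by
    refine ((integrableOn_exp_mul_Ioi (a := -(l / 2)) (by linarith) 0).const_mul
      (C * (2 / l))).mono'
      ((ContinuousOn.smul (by fun_prop) hPc).aestronglyMeasurable measurableSet_Ioi) ?_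
    exact ae_restrict_of_forall_mem measurableSet_Ioi hb2
  have hG : ∀ t ∈ Ioi (0 : ℝ), HasDerivAt (fun t => Real.exp (-(l * t)) • P t)
      (Real.exp (-(l * t)) • h t - l • (Real.exp (-(l * t)) • P t)) t := fun t ht => by
    have h1 : HasDerivAt (fun t : ℝ => Real.exp (-(l * t))) (Real.exp (-(l * t)) * (-l)) t := by
      have h2 := ((hasDerivAt_id t).const_mul l).neg
      rw [mul_one] at h2
      exact HasDerivAt.exp h2
    refine (h1.smul (hder t ht)).congr_deriv ?_
    rw [mul_comm (Real.exp _) (-l), neg_mul, neg_smul, mul_smul, sub_eq_add_neg]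
  have hlim : Tendsto (fun t => Real.exp (-(l * t)) • P t) atTop (𝓝 0) := by
    have h1 : Tendsto (fun t => C * (2 / l) * Real.exp (-(l / 2) * t)) atTop (𝓝 0) := by
      have : Tendsto (fun t : ℝ => -(l / 2) * t) atTop atBot :=
        tendsto_id.const_mul_atTop_of_neg (by linarith)
      simpa using (Real.tendsto_exp_atBot.comp this).const_mul (C * (2 / l))
    refine squeeze_zero_norm' ?_ h1
    filter_upwards [eventually_gt_atTop 0] with t ht using hb2 t ht
  -- Nothing is known about `h` at `0`; continuity of the primitive there comes from `‖P t‖ ≤ C t`.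
  have hc0 : ContinuousWithinAt (fun t => Real.exp (-(l * t)) • P t) (Ici 0) 0 := by
    have hP0 : P 0 = 0 := intervalIntegral.integral_same
    refine ContinuousWithinAt.smul (by fun_prop) ?_
    rw [ContinuousWithinAt, hP0]
    have h1 : Tendsto (fun t => C * t) (𝓝[≥] (0 : ℝ)) (𝓝 0) := by
      have : ContinuousAt (fun t : ℝ => C * t) 0 := by fun_prop
      simpa [ContinuousWithinAt] using this.continuousWithinAt (s := Ici 0)
    refine squeeze_zero_norm' ?_ h1
    filter_upwards [self_mem_nhdsWithin] with t ht
    rcases (show (0 : ℝ) ≤ t from ht).eq_or_lt with rfl | h0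
    · simp [hP0]
    · exact hP t h0
  have hi3 : IntegrableOn (fun t => l • Real.exp (-(l * t)) • P t) (Ioi 0) := hi2.smul l
  have := integral_Ioi_of_hasDerivAt_of_tendsto hc0 hG (hi1.sub hi3) hlim
  rw [integral_sub hi1 hi3, integral_smul] at this
  simp only [P, intervalIntegral.integral_same, smul_zero, sub_zero] at this
  exact sub_eq_zero.1 this

/-- An `ε/3` argument: the approximating sequence may depend on `ε`, but the error is uniform in
`n`. -/
lemma tendsto_of_forall_approx {α : Type*} [PseudoMetricSpace α] {a : ℕ → α} {a₀ : α} {C : ℝ}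
    (h : ∀ ε > 0, ∃ (b : ℕ → α) (b₀ : α), Tendsto b atTop (𝓝 b₀) ∧
      (∀ n, dist (a n) (b n) ≤ C * ε) ∧ dist a₀ b₀ ≤ C * ε) : Tendsto a atTop (𝓝 a₀) := by
  rw [Metric.tendsto_atTop]
  intro ε hε
  obtain ⟨b, b₀, hb, h1, h2⟩ := h (ε / (3 * (|C| + 1))) (by positivity)
  have h3 : C * (ε / (3 * (|C| + 1))) ≤ ε / 3 := by
    rw [← mul_div_assoc, div_le_div_iff₀ (by positivity) (by positivity)]
    nlinarith [le_abs_self C]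
  obtain ⟨N, hN⟩ := Metric.tendsto_atTop.1 hb (ε / 3) (by positivity)
  refine ⟨N, fun n hn => ?_⟩
  have h4 := dist_triangle4 (a n) (b n) b₀ a₀
  rw [dist_comm b₀ a₀] at h4
  linarith [h1 n, hN n hn]

/-! ### Strong and weak limits of operators -/

section Operators

variable {H : Type*} [NormedAddCommGroup H] [InnerProductSpace ℂ H]

lemma tendstoSOT_iff {T : ℕ → H →L[ℂ] H} {T₀ : H →L[ℂ] H} :
    TendstoSOT T T₀ ↔ ∀ f, Tendsto (fun n => T n f) atTop (𝓝 (T₀ f)) :=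
  PointwiseConvergenceCLM.tendsto_iff_forall_tendsto

lemma tendstoWOT_iff_inner [CompleteSpace H] {T : ℕ → H →L[ℂ] H} {T₀ : H →L[ℂ] H} :
    TendstoWOT T T₀ ↔ ∀ f g : H, Tendsto (fun n => inner ℂ g (T n f)) atTop
      (𝓝 (inner ℂ g (T₀ f))) := by
  rw [TendstoWOT, ContinuousLinearMapWOT.tendsto_iff_forall_dual_apply_tendsto]
  refine forall_congr' fun f => ?_
  exact (InnerProductSpace.toDual ℂ H).surjective.forall

lemma TendstoSOT.tendstoWOT [CompleteSpace H] {T : ℕ → H →L[ℂ] H} {T₀ : H →L[ℂ] H}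
    (h : TendstoSOT T T₀) : TendstoWOT T T₀ :=
  tendstoWOT_iff_inner.2 fun f _ => tendsto_const_nhds.inner (tendstoSOT_iff.1 h f)

/-- Expand `‖x n - x₀‖²`; weak convergence is needed only against `x₀`. -/
lemma tendsto_of_tendsto_inner_of_tendsto_inner_self {x : ℕ → H} {x₀ : H}
    (hw : Tendsto (fun n => inner ℂ x₀ (x n)) atTop (𝓝 (inner ℂ x₀ x₀)))
    (hn : Tendsto (fun n => inner ℂ (x n) (x n)) atTop (𝓝 (inner ℂ x₀ x₀))) :
    Tendsto x atTop (𝓝 x₀) := by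
  have hw' : Tendsto (fun n => inner ℂ (x n) x₀) atTop (𝓝 (inner ℂ x₀ x₀)) := by
    have := (Complex.continuous_conj.tendsto _).comp hw
    simpa [Function.comp_def] using this
  have h1 : Tendsto (fun n => inner ℂ (x n - x₀) (x n - x₀)) atTop (𝓝 0) := by
    have := ((hn.sub hw').sub hw).add (tendsto_const_nhds (x := inner ℂ x₀ x₀))
    rw [show (inner ℂ x₀ x₀ - inner ℂ x₀ x₀ - inner ℂ x₀ x₀ + inner ℂ x₀ x₀ : ℂ) = 0 by ring]
      at this
    refine this.congr fun n => ?_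
    simp only [inner_sub_left, inner_sub_right]
    ring
  have h2 := h1.norm
  simp only [inner_self_eq_norm_sq_to_K, norm_zero] at h2
  rw [tendsto_iff_norm_sub_tendsto_zero]
  have h3 := (Real.continuous_sqrt.tendsto _).comp h2
  simpa [Function.comp_def, Real.sqrt_sq] using h3

lemma tendsto_apply_of_norm_le {T : ℕ → H →L[ℂ] H} {T₀ : H →L[ℂ] H} {C : ℝ}
    (hC : ∀ n, ‖T n‖ ≤ C) (hT : ∀ f, Tendsto (fun n => T n f) atTop (𝓝 (T₀ f)))
    {x : ℕ → H} {x₀ : H} (hx : Tendsto x atTop (𝓝 x₀)) :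
    Tendsto (fun n => T n (x n)) atTop (𝓝 (T₀ x₀)) := by
  have h1 : Tendsto (fun n => T n (x n - x₀)) atTop (𝓝 0) := by
    have h2 : Tendsto (fun n => C * ‖x n - x₀‖) atTop (𝓝 0) := by
      simpa using (tendsto_iff_norm_sub_tendsto_zero.1 hx).const_mul C
    exact squeeze_zero_norm (fun n => (T n).le_of_opNorm_le (hC n) _) h2
  have := h1.add (hT x₀)
  rw [zero_add] at this
  refine this.congr fun n => ?_
  rw [map_sub, sub_add_cancel]

lemma tendsto_aeval_apply {R : ℕ → H →L[ℂ] H} {R₀ : H →L[ℂ] H} {C : ℝ} (hC : ∀ n, ‖R n‖ ≤ C)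
    (hR : ∀ f, Tendsto (fun n => R n f) atTop (𝓝 (R₀ f))) (p : Polynomial ℝ) (f : H) :
    Tendsto (fun n => Polynomial.aeval (R n) p f) atTop (𝓝 (Polynomial.aeval R₀ p f)) := by
  have hpow : ∀ k : ℕ, Tendsto (fun n => (R n ^ k) f) atTop (𝓝 ((R₀ ^ k) f)) := by
    intro k
    induction k with
    | zero => exact tendsto_const_nhds
    | succ k ih =>
      simp only [pow_succ']
      exact tendsto_apply_of_norm_le hC hR ih
  have e : ∀ T : H →L[ℂ] H, Polynomial.aeval T p f =
      ∑ i ∈ Finset.range (p.natDegree + 1), p.coeff i • (T ^ i) f := fun T => by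
    rw [Polynomial.aeval_eq_sum_range]
    simp
  simp only [e]
  exact tendsto_finsetSum _ fun i _ => (hpow i).const_smul _

/-- Strong convergence is preserved by the continuous functional calculus. -/
theorem tendsto_cfc_apply [CompleteSpace H] {R : ℕ → H →L[ℂ] H} {R₀ : H →L[ℂ] H} {C : ℝ} (hC : ∀ n, ‖R n‖ ≤ C)
    (hR : ∀ f, Tendsto (fun n => R n f) atTop (𝓝 (R₀ f)))
    (hsa : ∀ n, IsSelfAdjoint (R n)) (hsa₀ : IsSelfAdjoint R₀) {a b : ℝ}
    (hσ : ∀ n, spectrum ℝ (R n) ⊆ Icc a b) (hσ₀ : spectrum ℝ R₀ ⊆ Icc a b)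
    {F : ℝ → ℝ} (hF : ContinuousOn F (Icc a b)) (f : H) :
    Tendsto (fun n => cfc F (R n) f) atTop (𝓝 (cfc F R₀ f)) := by
  refine tendsto_of_forall_approx (C := ‖f‖) fun ε hε => ?_
  -- One polynomial serves all `n`, since all the spectra lie in the same interval.
  obtain ⟨p, hp⟩ := exists_polynomial_near_of_continuousOn a b F hF ε hε
  have key : ∀ T : H →L[ℂ] H, IsSelfAdjoint T → spectrum ℝ T ⊆ Icc a b →
      dist (cfc F T f) (Polynomial.aeval T p f) ≤ ‖f‖ * ε := fun T hT hTσ => by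
    rw [← cfc_polynomial p T hT, dist_eq_norm, ← sub_apply,
      ← cfc_sub _ _ _ (hF.mono hTσ) (by fun_prop), mul_comm]
    refine ContinuousLinearMap.le_of_opNorm_le _ (norm_cfc_le hε.le fun x hx => ?_) _
    rw [Real.norm_eq_abs, abs_sub_comm]
    exact (hp x (hTσ hx)).le
  exact ⟨_, _, tendsto_aeval_apply hC hR p f, fun n => key _ (hsa n) (hσ n), key _ hsa₀ hσ₀⟩

end Operators

/-! ### Weak and strong resolvent convergence -/

section Convergence

variable {H : Type*} [NormedAddCommGroup H] [InnerProductSpace ℂ H]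
  {A : ℕ → OpGraph H} {A₀ : OpGraph H} {S : ℕ → ℝ → H →L[ℂ] H} {S₀ : ℝ → H →L[ℂ] H}

/-- Strong convergence of the resolvents at one point implies it at every other point where the
resolvents are uniformly bounded. -/
lemma ResolventTendstoSOT.of_norm_le {l m : ℂ} (h : ResolventTendstoSOT A A₀ l)
    (hm : ResolventsExist A A₀ m) {C : ℝ} (hC : ∀ n, ‖(A n).resolvent m‖ ≤ C) :
    ResolventTendstoSOT A A₀ m := by
  refine ⟨hm, tendstoSOT_iff.2 fun f => ?_⟩
  have hT := tendstoSOT_iff.1 h.2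
  -- With this `u`, the error at `m` is `1 + (l - m)R_n(m)` applied to the error at `l` on the fixed
  -- vector `u`.
  set u := f + (l - m) • A₀.resolvent m f
  have e₀ : A₀.resolvent m f = A₀.resolvent l u := by
    refine OpGraph.eq_resolvent_of_mem h.1.2 ?_
    convert OpGraph.sub_smul_resolvent_mem hm.2 f using 2
    module
  have e : ∀ n, (A n).resolvent m f - A₀.resolvent m f =
      ((A n).resolvent l u - A₀.resolvent l u) +
        (l - m) • (A n).resolvent m ((A n).resolvent l u - A₀.resolvent l u) := by
    intro n
    have h1 := OpGraph.resolvent_sub_resolvent (hm.1 n) (h.1.1 n)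
    have h2 : (A n).resolvent m u = (A n).resolvent l u +
        (l - m) • (A n).resolvent m ((A n).resolvent l u) := by
      have := DFunLike.congr_fun h1 u
      change (A n).resolvent m u - (A n).resolvent l u =
        (l - m) • (A n).resolvent m ((A n).resolvent l u) at this
      rw [← this]; abel
    have h3 : (A n).resolvent m u = (A n).resolvent m f +
        (l - m) • (A n).resolvent m (A₀.resolvent l u) := by
      rw [← e₀]; simp [u]
    rw [e₀, map_sub, smul_sub]
    rw [h3] at h2
    rw [eq_sub_of_add_eq h2]
    abel
  have hd : Tendsto (fun n => (A n).resolvent l u - A₀.resolvent l u) atTop (𝓝 0) := by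
    simpa using (hT u).sub_const (A₀.resolvent l u)
  have hd2 : Tendsto (fun n => (A n).resolvent m ((A n).resolvent l u - A₀.resolvent l u))
      atTop (𝓝 0) := by
    refine squeeze_zero_norm (fun n => ((A n).resolvent m).le_of_opNorm_le (hC n) _) ?_
    simpa using hd.norm.const_mul C
  have := hd.add (hd2.const_smul (l - m))
  rw [smul_zero, add_zero] at this
  rw [← tendsto_sub_nhds_zero_iff]
  exact this.congr fun n => (e n).symm

variable [CompleteSpace H]

lemma resolventsExist (hA : ∀ n, (A n).SelfAdjoint ∧ (A n).Positive)
    (hA₀ : A₀.SelfAdjoint ∧ A₀.Positive) (hS : ∀ n, NegGenerates (A n) (S n))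
    (hS₀ : NegGenerates A₀ S₀) {l : ℂ} (hl : 0 < l.re) : ResolventsExist A A₀ l :=
  ⟨fun n => (hS n).boundedlyInvertible (hA n).2 hl, hS₀.boundedlyInvertible hA₀.2 hl⟩

lemma ResolventTendstoSOT.resolventTendstoWOT {l : ℂ} (h : ResolventTendstoSOT A A₀ l) :
    ResolventTendstoWOT A A₀ l :=
  ⟨h.1, h.2.tendstoWOT⟩

/-- Since `R(l)* = R(l̄)`, the resolvent identity gives `‖R(l)f‖² = (l - l̄)⁻¹⟨f, (R(l̄) - R(l))f⟩`,
and `⟨f, R(l̄)f⟩` is the conjugate of `⟨f, R(l)f⟩`. Hence weak convergence forces convergence of the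
norms. -/
lemma ResolventTendstoWOT.tendstoSOT_of_im_ne_zero {l : ℂ} (h : ResolventTendstoWOT A A₀ l)
    (hA : ∀ n, (A n).SelfAdjoint) (hA₀ : A₀.SelfAdjoint)
    (hl' : ResolventsExist A A₀ (starRingEnd ℂ l)) (hl : l.im ≠ 0) :
    ResolventTendstoSOT A A₀ l := by
  refine ⟨h.1, tendstoSOT_iff.2 fun f => ?_⟩
  have hw := tendstoWOT_iff_inner.1 h.2
  have hne : l - starRingEnd ℂ l ≠ 0 := by
    rw [Complex.sub_conj]
    simpa using hl
  have key : ∀ B : OpGraph H, B.SelfAdjoint → (OpGraph.scalarAdd l B).BoundedlyInvertible →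
      (OpGraph.scalarAdd (starRingEnd ℂ l) B).BoundedlyInvertible →
      inner ℂ (B.resolvent l f) (B.resolvent l f) = (l - starRingEnd ℂ l)⁻¹ *
        (starRingEnd ℂ (inner ℂ f (B.resolvent l f)) - inner ℂ f (B.resolvent l f)) := by
    intro B hB h1 h2
    rw [eq_inv_mul_iff_mul_eq₀ hne, inner_conj_symm, OpGraph.inner_resolvent_left hB h1 h2,
      OpGraph.inner_resolvent_left hB h1 h2, ← inner_sub_right, ← inner_smul_right]
    have := DFunLike.congr_fun (OpGraph.resolvent_sub_resolvent h2 h1) f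
    exact congrArg _ this.symm
  refine tendsto_of_tendsto_inner_of_tendsto_inner_self (hw _ _) ?_
  rw [key A₀ hA₀ h.1.2 hl'.2]
  simp only [key (A _) (hA _) (h.1.1 _) (hl'.1 _)]
  exact (((Complex.continuous_conj.tendsto _).comp (hw f f)).sub (hw f f)).const_mul _

lemma norm_resolvent_le_two_div {B : OpGraph H} {T : ℝ → H →L[ℂ] H} (hT : NegGenerates B T)
    (hB : B.Positive) {l m : ℝ} (hm : 0 < m) (hl : m / 2 < l) :
    ‖B.resolvent (l : ℂ)‖ ≤ 2 / m := by
  have hl0 : 0 < l := by linarith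
  refine (hT.norm_resolvent_le hB (l := l) (by simpa)).trans ?_
  rw [Complex.ofReal_re, div_le_div_iff₀ hl0 hm]
  linarith

/-- Weak convergence of the resolvents at real points accumulating at `m > 0` implies strong
convergence at `m`, because `R(m)² = lim (R(l) - R(m)) / (m - l)` uniformly in the sequence. -/
lemma resolventTendstoSOT_of_real_accumulation (hA : ∀ n, (A n).SelfAdjoint ∧ (A n).Positive)
    (hA₀ : A₀.SelfAdjoint ∧ A₀.Positive) (hS : ∀ n, NegGenerates (A n) (S n))
    (hS₀ : NegGenerates A₀ S₀) {m : ℝ} (hm : 0 < m)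
    (h : ∀ ε > 0, ∃ l : ℝ, l ≠ m ∧ |l - m| < ε ∧ ResolventTendstoWOT A A₀ (l : ℂ)) :
    ResolventTendstoSOT A A₀ (m : ℂ) := by
  have hex := resolventsExist hA hA₀ hS hS₀ (l := (m : ℂ)) (by simpa)
  refine ⟨hex, tendstoSOT_iff.2 fun f => ?_⟩
  set K := 2 / m
  have hK : 0 < K := by positivity
  have hnear : ∀ ε > 0, ∃ l : ℝ, l ≠ m ∧ |l - m| ≤ ε ∧ m / 2 < l ∧
      ResolventTendstoWOT A A₀ (l : ℂ) := fun ε hε => by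
    -- Staying within `m/2` of `m` keeps every resolvent bounded by `K = 2/m`.
    obtain ⟨l, h1, h2, h3⟩ := h (min ε (m / 2)) (by positivity)
    refine ⟨l, h1, (h2.trans_le (min_le_left _ _)).le, ?_, h3⟩
    have := (abs_lt.1 (h2.trans_le (min_le_right _ _))).1
    linarith
  have hdiff : ∀ (B : OpGraph H) (T : ℝ → H →L[ℂ] H), NegGenerates B T → B.Positive →
      ∀ l : ℝ, m / 2 < l → ‖B.resolvent (m : ℂ) - B.resolvent (l : ℂ)‖ ≤ |l - m| * (K * K) := by
    intro B T hT hB l hl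
    rw [OpGraph.resolvent_sub_resolvent (hT.boundedlyInvertible hB (by simpa))
      (hT.boundedlyInvertible hB (by rw [Complex.ofReal_re]; linarith)), norm_smul,
      ← Complex.ofReal_sub, Complex.norm_real, Real.norm_eq_abs]
    gcongr
    refine (norm_mul_le _ _).trans ?_
    gcongr
    · exact norm_resolvent_le_two_div hT hB hm (by linarith)
    · exact norm_resolvent_le_two_div hT hB hm hl
  -- The point `m` need not be among the given points; its weak convergence is inherited from them,
  -- as `R` is Lipschitz near `m` uniformly in `n`.
  have hweak : ∀ f g : H, Tendsto (fun n => inner ℂ g ((A n).resolvent (m : ℂ) f)) atTop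
      (𝓝 (inner ℂ g (A₀.resolvent (m : ℂ) f))) := by
    intro f g
    refine tendsto_of_forall_approx (C := ‖g‖ * (K * K * ‖f‖)) fun ε hε => ?_
    obtain ⟨l, -, hlε, hl2, hl⟩ := hnear ε hε
    have key : ∀ (B : OpGraph H) (T : ℝ → H →L[ℂ] H), NegGenerates B T → B.Positive →
        dist (inner ℂ g (B.resolvent (m : ℂ) f)) (inner ℂ g (B.resolvent (l : ℂ) f)) ≤
          ‖g‖ * (K * K * ‖f‖) * ε := by
      intro B T hT hB
      rw [dist_eq_norm, ← inner_sub_right, ← sub_apply]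
      calc _ ≤ ‖g‖ * ‖(B.resolvent (m : ℂ) - B.resolvent (l : ℂ)) f‖ := norm_inner_le_norm _ _
        _ ≤ ‖g‖ * (|l - m| * (K * K) * ‖f‖) := by
          gcongr
          exact ContinuousLinearMap.le_of_opNorm_le _ (hdiff B T hT hB l hl2) _
        _ ≤ ‖g‖ * (ε * (K * K) * ‖f‖) := by gcongr
        _ = _ := by ring
    exact ⟨_, _, tendstoWOT_iff_inner.1 hl.2 f g, fun n => key _ _ (hS n) (hA n).2,
      key _ _ hS₀ hA₀.2⟩
  refine tendsto_of_tendsto_inner_of_tendsto_inner_self (hweak _ _) ?_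
  refine tendsto_of_forall_approx (C := ‖f‖ * (K * K * (K * ‖f‖))) fun ε hε => ?_
  obtain ⟨l, hlm, hlε, hl2, hl⟩ := hnear ε hε
  have hne : ((m - l : ℝ) : ℂ) ≠ 0 := by
    rw [Complex.ofReal_ne_zero]; exact sub_ne_zero.2 hlm.symm
  have key : ∀ (B : OpGraph H) (T : ℝ → H →L[ℂ] H), NegGenerates B T → B.SelfAdjoint ∧ B.Positive →
      dist (inner ℂ (B.resolvent (m : ℂ) f) (B.resolvent (m : ℂ) f))
        (((m - l : ℝ) : ℂ)⁻¹ * (inner ℂ f (B.resolvent (l : ℂ) f) -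
          inner ℂ f (B.resolvent (m : ℂ) f))) ≤ ‖f‖ * (K * K * (K * ‖f‖)) * ε := by
    intro B T hT hB
    have hbm := hT.boundedlyInvertible hB.2 (l := (m : ℂ)) (by simpa)
    have hbl := hT.boundedlyInvertible hB.2 (l := (l : ℂ)) (by rw [Complex.ofReal_re]; linarith)
    have e1 : inner ℂ (B.resolvent (m : ℂ) f) (B.resolvent (m : ℂ) f) =
        inner ℂ f (B.resolvent (m : ℂ) (B.resolvent (m : ℂ) f)) := by
      rw [OpGraph.inner_resolvent_left hB.1 hbm (by simpa using hbm), Complex.conj_ofReal]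
    -- The difference quotient is exactly `R(l)R(m)`, which differs from `R(m)²` by `O(|l - m|)`
    -- uniformly in `n`.
    have e2 : ((m - l : ℝ) : ℂ)⁻¹ * (inner ℂ f (B.resolvent (l : ℂ) f) -
          inner ℂ f (B.resolvent (m : ℂ) f)) =
        inner ℂ f (B.resolvent (l : ℂ) (B.resolvent (m : ℂ) f)) := by
      rw [inv_mul_eq_iff_eq_mul₀ hne, ← inner_sub_right, ← inner_smul_right, Complex.ofReal_sub]
      exact congrArg _ (DFunLike.congr_fun (OpGraph.resolvent_sub_resolvent hbl hbm) f)
    rw [e1, e2, dist_eq_norm, ← inner_sub_right, ← sub_apply]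
    calc _ ≤ ‖f‖ * ‖(B.resolvent (m : ℂ) - B.resolvent (l : ℂ)) (B.resolvent (m : ℂ) f)‖ :=
          norm_inner_le_norm _ _
      _ ≤ ‖f‖ * (|l - m| * (K * K) * (K * ‖f‖)) := by
        gcongr
        refine (ContinuousLinearMap.le_of_opNorm_le _ (hdiff B T hT hB.2 l hl2) _).trans ?_
        gcongr
        exact ContinuousLinearMap.le_of_opNorm_le _
          (norm_resolvent_le_two_div hT hB.2 hm (by linarith)) _
      _ ≤ ‖f‖ * (ε * (K * K) * (K * ‖f‖)) := by gcongr
      _ = _ := by ring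
  exact ⟨_, _, ((tendstoWOT_iff_inner.1 hl.2 f f).sub (hweak f f)).const_mul _,
    fun n => key _ _ (hS n) (hA n), key _ _ hS₀ hA₀⟩

end Convergence

/-! ### Convergence of the semigroups -/

lemma NegGenerates.aestronglyMeasurable {X : Type*} [NormedAddCommGroup X] [NormedSpace ℂ X]
    {B : OpGraph X} {T : ℝ → X →L[ℂ] X} (hT : NegGenerates B T) (f : X) (b : ℝ) :
    AEStronglyMeasurable (fun t => T t f) (volume.restrict (Ioc 0 b)) :=
  (((hT.1.continuousOn f).mono Ioc_subset_Ioi_self).aestronglyMeasurable measurableSet_Ioc)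

lemma tendsto_apply_of_tendsto_iSup_enorm {X : Type*} [NormedAddCommGroup X] [NormedSpace ℂ X]
    {S : ℕ → ℝ → X →L[ℂ] X} {S₀ : ℝ → X →L[ℂ] X} {f : X}
    (h : ∀ δ T : ℝ, 0 < δ → δ < T →
      Tendsto (fun n => ⨆ t ∈ Icc δ T, ‖(S n t - S₀ t) f‖ₑ) atTop (𝓝 0)) {t : ℝ} (ht : 0 < t) :
    Tendsto (fun n => S n t f) atTop (𝓝 (S₀ t f)) := by
  rw [tendsto_iff_edist_tendsto_0]
  refine tendsto_of_tendsto_of_tendsto_of_le_of_le tendsto_const_nhds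
    (h t (t + 1) ht (by linarith)) (fun _ => zero_le) fun n => ?_
  rw [edist_eq_enorm_sub]
  exact le_iSup₂_of_le (f := fun t (_ : t ∈ Icc _ _) => ‖(S n t - S₀ t) f‖ₑ) t
    ⟨le_rfl, by linarith⟩ le_rfl

section SemigroupConvergence

variable {H : Type*} [NormedAddCommGroup H] [InnerProductSpace ℂ H] [CompleteSpace H]
  {A : ℕ → OpGraph H} {A₀ : OpGraph H} {S : ℕ → ℝ → H →L[ℂ] H} {S₀ : ℝ → H →L[ℂ] H}

lemma NegGenerates.integrableOn_inner {B : OpGraph H} {T : ℝ → H →L[ℂ] H}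
    (hT : NegGenerates B T) (hB : B.SelfAdjoint ∧ B.Positive) (f g : H) (b : ℝ) :
    IntegrableOn (fun t => inner ℂ g (T t f)) (Ioc 0 b) := by
  refine (integrable_const (‖g‖ * ‖f‖)).mono'
    (aestronglyMeasurable_const.inner (hT.aestronglyMeasurable f b)) ?_
  refine ae_restrict_of_forall_mem measurableSet_Ioc fun t ht => ?_
  exact (norm_inner_le_norm _ _).trans (by gcongr; exact hT.norm_apply_le hB ht.1 f)

lemma tendsto_apply_of_resolventTendstoSOT (hA : ∀ n, (A n).SelfAdjoint ∧ (A n).Positive)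
    (hA₀ : A₀.SelfAdjoint ∧ A₀.Positive) (hS : ∀ n, NegGenerates (A n) (S n))
    (hS₀ : NegGenerates A₀ S₀) (h : ResolventTendstoSOT A A₀ 1) {t : ℝ} (ht : 0 < t) (f : H) :
    Tendsto (fun n => S n t f) atTop (𝓝 (S₀ t f)) := by
  rw [hS₀.eq_cfc_heatSymbol hA₀ ht]
  simp only [fun n => (hS n).eq_cfc_heatSymbol (hA n) ht]
  refine tendsto_cfc_apply (C := 1)
    (fun n => by simpa using (hS n).norm_resolvent_le (hA n).2 (l := 1) (by simp))
    (tendstoSOT_iff.1 h.2) (fun n => (hS n).isSelfAdjoint_resolvent_one (hA n))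
    (hS₀.isSelfAdjoint_resolvent_one hA₀) (fun n => (hS n).spectrum_resolvent_one_subset (hA n))
    (hS₀.spectrum_resolvent_one_subset hA₀) (continuousOn_heatSymbol ht) f

/-- Pointwise strong convergence on `(0, ∞)` is uniform on `[δ, T]`, since all the semigroups are
Lipschitz continuous with the same constant there. -/
lemma tendsto_iSup_enorm_of_tendsto_apply (hA : ∀ n, (A n).SelfAdjoint ∧ (A n).Positive)
    (hA₀ : A₀.SelfAdjoint ∧ A₀.Positive) (hS : ∀ n, NegGenerates (A n) (S n))
    (hS₀ : NegGenerates A₀ S₀) {f : H}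
    (h : ∀ t : ℝ, 0 < t → Tendsto (fun n => S n t f) atTop (𝓝 (S₀ t f))) {δ : ℝ} (hδ : 0 < δ)
    (T : ℝ) : Tendsto (fun n => ⨆ t ∈ Icc δ T, ‖(S n t - S₀ t) f‖ₑ) atTop (𝓝 0) := by
  rw [ENNReal.tendsto_nhds_zero]
  intro ε hε
  -- The tolerance `ε` may be infinite, so a finite `r` is put below it.
  obtain ⟨r, hr0, hrε⟩ := ENNReal.lt_iff_exists_nnreal_btwn.1 hε
  have hr : 0 < (r : ℝ) := by exact_mod_cast hr0
  -- With Lipschitz constant `1/δ`, moving to a point of the `η`-net costs at most `r/4` for each of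
  -- the two semigroups, leaving `r/2` for the net points.
  set η : ℝ := r * δ / (4 * (‖f‖ + 1)) with hη
  have hη0 : 0 < η := by positivity
  obtain ⟨s, hsub, hfin, hcov⟩ := (isCompact_Icc (a := δ) (b := T)).finite_cover_balls hη0
  have hev : ∀ᶠ n in atTop, ∀ t ∈ s, ‖S n t f - S₀ t f‖ < r / 2 := by
    rw [eventually_all_finite hfin]
    intro t ht
    have h1 := h t (hδ.trans_le (hsub ht).1)
    rw [tendsto_iff_norm_sub_tendsto_zero] at h1
    exact h1.eventually_lt_const (by positivity)
  filter_upwards [hev] with n hn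
  refine (iSup₂_le fun t ht => ?_).trans hrε.le
  rw [← ofReal_norm, ← ENNReal.ofReal_coe_nnreal]
  refine ENNReal.ofReal_le_ofReal ?_
  obtain ⟨u, hu, htu⟩ := mem_iUnion₂.1 (hcov ht)
  rw [Metric.mem_ball, Real.dist_eq] at htu
  have hlip : ∀ (B : OpGraph H) (U : ℝ → H →L[ℂ] H), NegGenerates B U →
      B.SelfAdjoint ∧ B.Positive → ‖U t f - U u f‖ ≤ r / 4 := by
    intro B U hU hB
    have h1 : ‖U t - U u‖ ≤ |t - u| / δ := by
      rcases le_total u t with hle | hle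
      · rw [abs_of_nonneg (sub_nonneg.2 hle)]
        exact hU.norm_sub_le hB hδ (hsub hu).1 hle
      · rw [norm_sub_rev, abs_sub_comm, abs_of_nonneg (sub_nonneg.2 hle)]
        exact hU.norm_sub_le hB hδ ht.1 hle
    calc ‖U t f - U u f‖ ≤ |t - u| / δ * ‖f‖ := ContinuousLinearMap.le_of_opNorm_le _ h1 f
      _ ≤ η / δ * (‖f‖ + 1) := by gcongr; linarith
      _ = r / 4 := by rw [hη]; field_simp
  have e : (S n t - S₀ t) f =
      (S n t f - S n u f) + (S n u f - S₀ u f) - (S₀ t f - S₀ u f) := by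
    rw [sub_apply]; abel
  rw [e]
  have h1 := hlip _ _ (hS n) (hA n)
  have h2 := hlip _ _ hS₀ hA₀
  linarith [norm_sub_le ((S n t f - S n u f) + (S n u f - S₀ u f)) (S₀ t f - S₀ u f),
    norm_add_le (S n t f - S n u f) (S n u f - S₀ u f), hn u hu]

lemma tendsto_integral_inner_of_tendstoWOT (hA : ∀ n, (A n).SelfAdjoint ∧ (A n).Positive)
    (hS : ∀ n, NegGenerates (A n) (S n))
    (h : ∀ t : ℝ, 0 < t → TendstoWOT (fun n => S n t) (S₀ t)) {T : ℝ} (hT : 0 < T) (f : H)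
    {g : ℝ → H} (hg : IntegrableOn g (Icc 0 T)) :
    Tendsto (fun n => ∫ t in (0 : ℝ)..T, inner ℂ (g t) (S n t f)) atTop
      (𝓝 (∫ t in (0 : ℝ)..T, inner ℂ (g t) (S₀ t f))) := by
  have hg' : IntegrableOn g (Ioc 0 T) := hg.mono_set Ioc_subset_Icc_self
  simp only [intervalIntegral.integral_of_le hT.le]
  refine tendsto_integral_of_dominated_convergence (fun t => ‖g t‖ * ‖f‖)
    (fun n => hg'.aestronglyMeasurable.inner ((hS n).aestronglyMeasurable f T))
    (hg'.norm.mul_const _) (fun n => ?_) ?_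
  · refine ae_restrict_of_forall_mem measurableSet_Ioc fun t ht => ?_
    exact (norm_inner_le_norm _ _).trans (by gcongr; exact (hS n).norm_apply_le (hA n) ht.1 f)
  · exact ae_restrict_of_forall_mem measurableSet_Ioc fun t ht =>
      tendstoWOT_iff_inner.1 (h t ht.1) f (g t)

lemma tendsto_integral_norm_of_tendsto_apply (hA : ∀ n, (A n).SelfAdjoint ∧ (A n).Positive)
    (hA₀ : A₀.SelfAdjoint ∧ A₀.Positive) (hS : ∀ n, NegGenerates (A n) (S n))
    (hS₀ : NegGenerates A₀ S₀) {f : H}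
    (h : ∀ t : ℝ, 0 < t → Tendsto (fun n => S n t f) atTop (𝓝 (S₀ t f))) {T : ℝ} (hT : 0 < T) :
    Tendsto (fun n => ∫ t in (0 : ℝ)..T, ‖(S n t - S₀ t) f‖) atTop (𝓝 0) := by
  simp only [intervalIntegral.integral_of_le hT.le, sub_apply]
  have := tendsto_integral_of_dominated_convergence (μ := volume.restrict (Ioc 0 T))
    (F := fun n t => ‖S n t f - S₀ t f‖) (f := fun _ => 0) (fun _ => ‖f‖ + ‖f‖)
    (fun n => (((hS n).aestronglyMeasurable f T).sub (hS₀.aestronglyMeasurable f T)).norm)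
    (integrable_const _) (fun n => ?_) ?_
  · simpa using this
  · refine ae_restrict_of_forall_mem measurableSet_Ioc fun t ht => ?_
    rw [norm_norm]
    exact (norm_sub_le _ _).trans
      (add_le_add ((hS n).norm_apply_le (hA n) ht.1 f) (hS₀.norm_apply_le hA₀ ht.1 f))
  · exact ae_restrict_of_forall_mem measurableSet_Ioc fun t ht =>
      tendsto_iff_norm_sub_tendsto_zero.1 (h t ht.1)

lemma tendsto_integral_inner_of_tendsto_integral_norm
    (hA : ∀ n, (A n).SelfAdjoint ∧ (A n).Positive)
    (hA₀ : A₀.SelfAdjoint ∧ A₀.Positive) (hS : ∀ n, NegGenerates (A n) (S n))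
    (hS₀ : NegGenerates A₀ S₀) {f : H} {T : ℝ} (hT : 0 < T)
    (h : Tendsto (fun n => ∫ t in (0 : ℝ)..T, ‖(S n t - S₀ t) f‖) atTop (𝓝 0)) (g : H) :
    Tendsto (fun n => ∫ t in (0 : ℝ)..T, inner ℂ g (S n t f)) atTop
      (𝓝 (∫ t in (0 : ℝ)..T, inner ℂ g (S₀ t f))) := by
  rw [tendsto_iff_norm_sub_tendsto_zero]
  have h1 := h.const_mul ‖g‖
  rw [mul_zero] at h1
  refine squeeze_zero (fun _ => norm_nonneg _) (fun n => ?_) h1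
  simp only [intervalIntegral.integral_of_le hT.le]
  rw [← integral_sub ((hS n).integrableOn_inner (hA n) f g T) (hS₀.integrableOn_inner hA₀ f g T),
    ← integral_const_mul]
  have hint : IntegrableOn (fun t => ‖(S n t - S₀ t) f‖) (Ioc 0 T) := by
    refine (integrable_const (‖f‖ + ‖f‖)).mono'
      (((hS n).aestronglyMeasurable f T).sub (hS₀.aestronglyMeasurable f T)).norm ?_
    refine ae_restrict_of_forall_mem measurableSet_Ioc fun t ht => ?_
    rw [norm_norm]
    exact (norm_sub_le _ _).trans
      (add_le_add ((hS n).norm_apply_le (hA n) ht.1 f) (hS₀.norm_apply_le hA₀ ht.1 f))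
  refine norm_integral_le_of_norm_le (hint.const_mul _) (.of_forall fun t => ?_)
  rw [← inner_sub_right]
  exact norm_inner_le_norm _ _

/-- Integration by parts writes the resolvent as a Laplace integral of the primitives, which
converge pointwise by hypothesis and are dominated by `‖g‖‖f‖t`. -/
lemma resolventTendstoWOT_ofReal_of_tendsto_integral_inner
    (hA : ∀ n, (A n).SelfAdjoint ∧ (A n).Positive)
    (hA₀ : A₀.SelfAdjoint ∧ A₀.Positive) (hS : ∀ n, NegGenerates (A n) (S n))
    (hS₀ : NegGenerates A₀ S₀)
    (h : ∀ T : ℝ, 0 < T → ∀ f g : H,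
        Tendsto (fun n => ∫ t in (0 : ℝ)..T, inner ℂ g (S n t f)) atTop
          (𝓝 (∫ t in (0 : ℝ)..T, inner ℂ g (S₀ t f)))) {l : ℝ} (hl : 0 < l) :
    ResolventTendstoWOT A A₀ (l : ℂ) := by
  refine ⟨resolventsExist hA hA₀ hS hS₀ (by simpa), tendstoWOT_iff_inner.2 fun f g => ?_⟩
  have hcont : ∀ (B : OpGraph H) (U : ℝ → H →L[ℂ] H), NegGenerates B U →
      ContinuousOn (fun t => inner ℂ g (U t f)) (Ioi 0) := fun B U hU =>
    continuousOn_const.inner (𝕜 := ℂ) (hU.1.continuousOn f)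
  have hbd : ∀ (B : OpGraph H) (U : ℝ → H →L[ℂ] H), NegGenerates B U →
      B.SelfAdjoint ∧ B.Positive → ∀ t, 0 < t → ‖inner ℂ g (U t f)‖ ≤ ‖g‖ * ‖f‖ :=
    fun B U hU hB t ht =>
      (norm_inner_le_norm _ _).trans (by gcongr; exact hU.norm_apply_le hB ht f)
  have key : ∀ (B : OpGraph H) (U : ℝ → H →L[ℂ] H), NegGenerates B U →
      B.SelfAdjoint ∧ B.Positive → inner ℂ g (B.resolvent (l : ℂ) f) =
        l • ∫ t in Ioi (0 : ℝ), Real.exp (-(l * t)) • ∫ s in (0 : ℝ)..t, inner ℂ g (U s f) := by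
    intro B U hU hB
    obtain ⟨hi, hv⟩ := hU.laplace_eq_resolvent hB hl f
    rw [← laplace_eq_mul_laplace_primitive (hcont B U hU) (hbd B U hU hB) hl, ← hv,
      ← integral_inner hi]
    refine integral_congr_ae (.of_forall fun t => ?_)
    simp only [inner_smul_right_eq_smul]
  rw [key A₀ S₀ hS₀ hA₀]
  simp only [fun n => key (A n) (S n) (hS n) (hA n)]
  refine Tendsto.const_smul ?_ l
  have hint : IntegrableOn (fun t => Real.exp (-(l * t)) * (‖g‖ * ‖f‖ * t)) (Ioi 0) := by
    have := integrableOn_rpow_mul_exp_neg_mul_rpow (p := 1) (s := 1) (b := l)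
      (by norm_num) one_pos hl
    refine IntegrableOn.congr_fun (this.const_mul (‖g‖ * ‖f‖)) (fun t _ => ?_) measurableSet_Ioi
    simp only [Real.rpow_one, neg_mul]
    ring
  refine tendsto_integral_of_dominated_convergence _ (fun n => ?_) hint (fun n => ?_) ?_
  · have hP : ContinuousOn (fun t => ∫ s in (0 : ℝ)..t, inner ℂ g (S n s f)) (Ioi 0) := by
      intro t ht
      rw [mem_Ioi] at ht
      have hii : IntervalIntegrable (fun s => inner ℂ g (S n s f)) volume 0 t := by
        rw [intervalIntegrable_iff_integrableOn_Ioc_of_le ht.le]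
        exact (hS n).integrableOn_inner (hA n) f g t
      exact (intervalIntegral.integral_hasDerivAt_right hii
        ⟨Ioi 0, Ioi_mem_nhds ht, (hcont _ _ (hS n)).aestronglyMeasurable measurableSet_Ioi⟩
        ((hcont _ _ (hS n)).continuousAt (Ioi_mem_nhds ht))).continuousAt.continuousWithinAt
    have hE : ContinuousOn (fun t => Real.exp (-(l * t))) (Ioi 0) := by fun_prop
    exact (hE.smul hP).aestronglyMeasurable measurableSet_Ioi
  · refine ae_restrict_of_forall_mem measurableSet_Ioi fun t ht => ?_
    rw [mem_Ioi] at ht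
    rw [norm_smul, Real.norm_eq_abs, abs_of_pos (Real.exp_pos _)]
    gcongr
    have := intervalIntegral.norm_integral_le_of_norm_le_const (a := 0) (b := t)
      (C := ‖g‖ * ‖f‖) (f := fun s => inner ℂ g (S n s f))
      fun s hs => hbd _ _ (hS n) (hA n) s (by rw [uIoc_of_le ht.le] at hs; exact hs.1)
    simpa [abs_of_pos ht] using this
  · exact ae_restrict_of_forall_mem measurableSet_Ioi fun t ht => (h t ht f g).const_smul _

/-- Either `D` has a non-real point in the right half-plane, and that point alone suffices, or `D`
is real near `m`, so that `m` is real and a limit of real points of `D`. -/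
lemma exists_resolventTendstoSOT_of_accPt (hA : ∀ n, (A n).SelfAdjoint ∧ (A n).Positive)
    (hA₀ : A₀.SelfAdjoint ∧ A₀.Positive) (hS : ∀ n, NegGenerates (A n) (S n))
    (hS₀ : NegGenerates A₀ S₀) {D : Set ℂ} {m : ℂ} (hm : 0 < m.re) (hD : AccPt m (𝓟 D))
    (h : ∀ l ∈ D, ResolventTendstoWOT A A₀ l) :
    ∃ l : ℂ, 0 < l.re ∧ ResolventTendstoSOT A A₀ l := by
  by_cases hreal : ∃ l ∈ D, 0 < l.re ∧ l.im ≠ 0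
  · obtain ⟨l, hlD, hl, him⟩ := hreal
    exact ⟨l, hl, (h l hlD).tendstoSOT_of_im_ne_zero (fun n => (hA n).1) hA₀.1
      (resolventsExist hA hA₀ hS hS₀ (by simpa)) him⟩
  · push Not at hreal
    rw [accPt_iff_frequently] at hD
    have hnear : ∀ ε > 0, ∃ l ∈ D, l ≠ m ∧ ‖l - m‖ < ε ∧ l.im = 0 := by
      intro ε hε
      have hev : ∀ᶠ l in 𝓝 m, ‖l - m‖ < ε ∧ 0 < l.re := by
        refine Filter.Eventually.and ?_
          (Complex.continuous_re.continuousAt.eventually (lt_mem_nhds hm))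
        filter_upwards [Metric.ball_mem_nhds m hε] with l hl
        rwa [Metric.mem_ball, dist_eq_norm] at hl
      obtain ⟨l, ⟨hlm, hlD⟩, hl1, hl2⟩ := (hD.and_eventually hev).exists
      exact ⟨l, hlD, hlm, hl1, hreal l hlD hl2⟩
    have him : m.im = 0 := by
      by_contra h0
      obtain ⟨l, -, -, hl, hl0⟩ := hnear |m.im| (abs_pos.2 h0)
      have := Complex.abs_im_le_norm (l - m)
      rw [Complex.sub_im, hl0, zero_sub, abs_neg] at this
      linarith
    have hmr : (m.re : ℂ) = m := Complex.ext (by simp) (by simp [him])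
    refine ⟨m, hm, ?_⟩
    rw [← hmr]
    refine resolventTendstoSOT_of_real_accumulation hA hA₀ hS hS₀ hm fun ε hε => ?_
    obtain ⟨l, hlD, hlm, hl, hl0⟩ := hnear ε hε
    have hlr : (l.re : ℂ) = l := Complex.ext (by simp) (by simp [hl0])
    refine ⟨l.re, fun e => hlm (by rw [← hlr, e, hmr]), ?_, by rw [hlr]; exact h l hlD⟩
    exact lt_of_le_of_lt (by simpa using Complex.abs_re_le_norm (l - m)) hl

end SemigroupConvergence

end

/-! ### The equivalences -/

theorem theorem3p1 {H : Type*} [NormedAddCommGroup H] [InnerProductSpace ℂ H] [CompleteSpace H]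
    (A : ℕ → OpGraph H) (A₀ : OpGraph H)
    (hA : ∀ n, OpGraph.SelfAdjoint (A n) ∧ OpGraph.Positive (A n))
    (hA₀ : OpGraph.SelfAdjoint A₀ ∧ OpGraph.Positive A₀)
    (S : ℕ → ℝ → H →L[ℂ] H) (S₀ : ℝ → H →L[ℂ] H)
    (hS : ∀ n, NegGenerates (A n) (S n)) (hS₀ : NegGenerates A₀ S₀) :
    List.TFAE [
      ∀ t : ℝ, 0 < t → TendstoWOT (fun n => S n t) (S₀ t),
      ∀ T : ℝ, 0 < T → ∀ f g : H,
        Tendsto (fun n => ∫ t in (0 : ℝ)..T, inner ℂ g (S n t f)) atTop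
          (𝓝 (∫ t in (0 : ℝ)..T, inner ℂ g (S₀ t f))),
      ∀ T : ℝ, 0 < T → ∀ (f : H) (g : ℝ → H), IntegrableOn g (Icc 0 T) →
        Tendsto (fun n => ∫ t in (0 : ℝ)..T, inner ℂ (g t) (S n t f)) atTop
          (𝓝 (∫ t in (0 : ℝ)..T, inner ℂ (g t) (S₀ t f))),
      ∀ T : ℝ, 0 < T → ∀ f : H,
        Tendsto (fun n => ∫ t in (0 : ℝ)..T, ‖(S n t - S₀ t) f‖) atTop (𝓝 0),
      ∀ l : ℂ, 0 < l.re → ResolventTendstoSOT A A₀ l,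
      ∃ l : ℂ, 0 < l.re ∧ ResolventTendstoSOT A A₀ l,
      ∀ l : ℂ, 0 < l.re → ResolventTendstoWOT A A₀ l,
      ∃ D : Set ℂ, (∃ μ : ℂ, 0 < μ.re ∧ AccPt μ (𝓟 D)) ∧ ∀ l ∈ D, ResolventTendstoWOT A A₀ l,
      ∃ l : ℂ, l.im ≠ 0 ∧ 0 < l.re ∧ ResolventTendstoWOT A A₀ l,
      ∀ (f : H) (δ T : ℝ), 0 < δ → δ < T →
        Tendsto (fun n => ⨆ t ∈ Icc δ T, ‖(S n t - S₀ t) f‖ₑ) atTop (𝓝 0)] := by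
  have hex : ∀ {l : ℂ}, 0 < l.re → ResolventsExist A A₀ l := resolventsExist hA hA₀ hS hS₀
  tfae_have 10 → 1 := fun h t ht => tendstoWOT_iff_inner.2 fun f _ =>
    tendsto_const_nhds.inner (tendsto_apply_of_tendsto_iSup_enorm (h f) ht)
  tfae_have 1 → 3 := fun h _ hT f _ hg => tendsto_integral_inner_of_tendstoWOT hA hS h hT f hg
  tfae_have 3 → 2 := fun h T hT f g => h T hT f (fun _ => g) (integrableOn_const (by simp))
  tfae_have 10 → 4 := fun h _ hT f => tendsto_integral_norm_of_tendsto_apply hA hA₀ hS hS₀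
    (fun _ ht => tendsto_apply_of_tendsto_iSup_enorm (h f) ht) hT
  tfae_have 4 → 2 := fun h T hT f g =>
    tendsto_integral_inner_of_tendsto_integral_norm hA hA₀ hS hS₀ hT (h T hT f) g
  -- All positive real points are available, so those just above `1` accumulate at `1`.
  tfae_have 2 → 6 := fun h => by
    refine ⟨((1 : ℝ) : ℂ), by simp, resolventTendstoSOT_of_real_accumulation hA hA₀ hS hS₀
      one_pos fun ε hε => ⟨1 + ε / 2, by linarith, ?_, ?_⟩⟩
    · rw [add_sub_cancel_left, abs_of_pos (by positivity)]
      linarith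
    · exact resolventTendstoWOT_ofReal_of_tendsto_integral_inner hA hA₀ hS hS₀ h (by positivity)
  tfae_have 6 → 5 := fun ⟨_, _, h⟩ _ hm =>
    h.of_norm_le (hex hm) fun n => (hS n).norm_resolvent_le (hA n).2 hm
  tfae_have 5 → 10 := fun h _ _ T hδ _ => tendsto_iSup_enorm_of_tendsto_apply hA hA₀ hS hS₀
    (fun _ ht => tendsto_apply_of_resolventTendstoSOT hA hA₀ hS hS₀ (h 1 (by simp)) ht _) hδ T
  tfae_have 5 → 7 := fun h l hl => (h l hl).resolventTendstoWOT
  tfae_have 7 → 8 := fun h => by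
    refine ⟨{l | 0 < l.re}, ⟨1, by simp, ?_⟩, h⟩
    have ho : IsOpen {l : ℂ | 0 < l.re} := isOpen_lt continuous_const Complex.continuous_re
    rw [accPt_iff_frequently_nhdsNE]
    exact (Filter.Eventually.frequently
      (eventually_nhdsWithin_of_eventually_nhds (ho.mem_nhds (by simp))))
  tfae_have 8 → 6 := fun ⟨_, ⟨_, hm, hD⟩, h⟩ =>
    exists_resolventTendstoSOT_of_accPt hA hA₀ hS hS₀ hm hD h
  tfae_have 7 → 9 := fun h => ⟨1 + Complex.I, by simp, by simp, h _ (by simp)⟩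
  tfae_have 9 → 6 := fun ⟨l, him, hl, h⟩ => ⟨l, hl, h.tendstoSOT_of_im_ne_zero
    (fun n => (hA n).1) hA₀.1 (hex (by simpa)) him⟩
  tfae_finish
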